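/- Setting. Let $d\in\{1,2,3\}$ and let $\Omega\subset\mathbb R^d$ be a bounded domain (open, connected, nonempty) that is convex or has a $C^{1,1}$ boundary. Let $F\in C^2(\mathbb R)$, $f:=F'$, with $f'\ge-\beta$ for some $\beta\in(0,\infty)$; if $d\in\{2,3\}$, suppose in addition $|f(s)|\le c_1(|s|^p+1)$ for all $s\in\mathbb R$, for some $c_1\in(0,\infty)$ and some $p\in[1,\infty)$ (if $d=2$), $p\in[1,5]$ (if $d=3$). Let $A:\mathbb R\to\mathbb R$ be Lipschitz continuous with $A_*\le A\le A^*$ for constants $A_*,A^*\in(0,\infty)$, and let $K'=A$, $K(0)=0$. Fix $m\in\mathbb R$. Let $H^1_{av}(\Omega)=\{\phi\in H^1(\Omega):\int_\Omega\phi\,dx=0\}$ with inner product $\int_\Omega\nabla\phi\cdot\nabla\psi\,dx$, let $(H^1_{av}(\Omega))'$ be its dual, and put $$H=(H^1_{av}(\Omega))'\times L^2(\Omega),\qquad H^*=H^1_{av}(\Omega)\times L^2(\Omega),\qquad \langle(\mu,\xi),(v,y)\rangle_{H^*,H}=\langle v,\mu\rangle+\int_\Omega\xi y\,dx.$$ Let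 $\mathcal H_m=\{(m+w,z):(w,z)\in H\}$ be the corresponding affine space over $H$; here a mean-free function $\phi\in L^2(\Omega)$ is identified with the functional $\psi\mapsto\int_\Omega\phi\psi\,dx$ in $(H^1_{av}(\Omega))'$. Define $\mathcal E:\mathcal H_m\to(-\infty,+\infty]$ by $$\mathcal E(u,z)=\int_\Omega\Bigl(\tfrac12|\nabla u|^2+F(u)+\tfrac12(z-K(u))^2\Bigr)dx\quad\text{if }u-m\in H^1_{av}(\Omega),\qquad \mathcal E(u,z)=+\infty\text{ otherwise},$$ and, for $\mathbf u\in\mathcal H_m$ with $\mathcal E(\mathbf u)<\infty$, its Gateaux subdifferential $$\partial_G\mathcal E(\mathbf u)=\Bigl\{\boldsymbol\mu\in H^*:\ \forall\,\mathbf v\in H:\ \liminf_{t\searrow0}\tfrac1t\bigl(\mathcal E(\mathbf u+t\mathbf v)-\mathcal E(\mathbf u)\bigr)\ge\langle\boldsymbol\mu,\mathbf v\rangle_{H^*,H}\Bigr\};$$ set $\partial_G\mathcal E(\mathbf u)=\emptyset$ if $\mathcal E(\mathbf u)=+\infty$. Proposition (chain rule). Let $0<T<\infty$. Let $\mathbf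 u=(u,z):[0,T]\to\mathcal H_m$ be absolutely continuous with derivative $\dot{\mathbf u}\in L^2(0,T;H)$, and suppose $\mathbf u\in L^2(0,T;H^2(\Omega)\times L^\infty(\Omega))$. Let $\boldsymbol\mu\in L^2(0,T;H^*)$ be such that $\boldsymbol\mu(t)\in\partial_G\mathcal E(\mathbf u(t))$ for almost every $t\in(0,T)$. Then $\mathcal E(\mathbf u(t))$ is finite for every $t\in[0,T]$ (and nonnegative if $F\ge0$), the function $\mathcal E\circ\mathbf u:[0,T]\to\mathbb R$ is absolutely continuous, and for almost every $t\in(0,T)$ $$\frac{d}{dt}\mathcal E(\mathbf u(t))=\langle\boldsymbol\mu(t),\dot{\mathbf u}(t)\rangle_{H^*,H}.$$ -/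

import Mathlib

open MeasureTheory Set Filter Topology
open scoped ENNReal NNReal ContDiff InnerProductSpace

noncomputable section

namespace PhaseSep

/-- The ambient Euclidean space `ℝ^d`. -/
abbrev Space (d : ℕ) : Type := EuclideanSpace ℝ (Fin d)

variable {d : ℕ}

/-! ### Domains -/

/-- `Ω` has a boundary of class `C^{1,1}`: near each boundary point `x₀`, after a choice of a unit
vector `e`, the set `Ω` is the strict epigraph in direction `e` of a function `γ` of the component
`x - ⟪e, x⟫ e` of `x` orthogonal to `e`, where `γ` is `C^1` with Lipschitz derivative. -/
def HasC11Boundary (Ω : Set (Space d)) : Prop :=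
  ∀ x₀ ∈ frontier Ω, ∃ r : ℝ, 0 < r ∧ ∃ e : Space d, ‖e‖ = 1 ∧ ∃ γ : Space d → ℝ,
    ContDiff ℝ 1 γ ∧ (∃ L : ℝ≥0, LipschitzWith L (fderiv ℝ γ)) ∧
    Ω ∩ Metric.ball x₀ r =
      {x | γ (x - ⟪e, x⟫_ℝ • e) < ⟪e, x⟫_ℝ} ∩ Metric.ball x₀ r

/-- A bounded domain (open, connected, nonempty) that is convex or has a `C^{1,1}` boundary. -/
structure IsAdmissibleDomain (Ω : Set (Space d)) : Prop where
  isOpen : IsOpen Ω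
  isConnected : IsConnected Ω
  isBounded : Bornology.IsBounded Ω
  convex_or_C11 : Convex ℝ Ω ∨ HasC11Boundary Ω

/-! ### Lebesgue and Sobolev spaces on `Ω` -/

/-- `L^p(Ω; V)`. -/
abbrev LpOn (Ω : Set (Space d)) (V : Type) [NormedAddCommGroup V] (p : ℝ≥0∞) : Type :=
  Lp V p ((volume : Measure (Space d)).restrict Ω)

/-- `g` is the weak (distributional) derivative of `f` in `Ω`: for all `η ∈ C_c^∞(Ω)` and all
directions `e`, `∫_Ω (∂_e η) f dx = - ∫_Ω η (g e) dx`. -/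
def IsWeakFDeriv (Ω : Set (Space d)) {V : Type} [NormedAddCommGroup V] [NormedSpace ℝ V]
    (f : Space d → V) (g : Space d → (Space d →L[ℝ] V)) : Prop :=
  ∀ η : Space d → ℝ, ContDiff ℝ ∞ η → HasCompactSupport η → tsupport η ⊆ Ω → ∀ e : Space d,
    ∫ x in Ω, (fderiv ℝ η x e) • f x = - ∫ x in Ω, η x • g x e

/-- `g` is the weak gradient of the scalar function `f` in `Ω`. -/
def IsWeakGrad (Ω : Set (Space d)) (f : Space d → ℝ) (g : Space d → Space d) : Prop :=
  IsWeakFDeriv Ω f (fun x => innerSL ℝ (g x))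

/-- The weak derivative only depends on the almost-everywhere classes. -/
lemma IsWeakFDeriv.congr {Ω : Set (Space d)} {V : Type} [NormedAddCommGroup V]
    [NormedSpace ℝ V] {f f' : Space d → V} {g g' : Space d → (Space d →L[ℝ] V)}
    (h : IsWeakFDeriv Ω f g) (hf : f' =ᵐ[volume.restrict Ω] f)
    (hg : g' =ᵐ[volume.restrict Ω] g) : IsWeakFDeriv Ω f' g' := by
  intro η h1 h2 h3 e
  have e1 : ∫ x in Ω, (fderiv ℝ η x e) • f' x = ∫ x in Ω, (fderiv ℝ η x e) • f x :=
    integral_congr_ae (by filter_upwards [hf] with x hx; rw [hx])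
  have e2 : ∫ x in Ω, η x • g' x e = ∫ x in Ω, η x • g x e :=
    integral_congr_ae (by filter_upwards [hg] with x hx; rw [hx])
  rw [e1, e2]; exact h η h1 h2 h3 e

/-- An `L^2(Ω)` function times a continuous compactly supported function is integrable on `Ω`. -/
lemma integrable_test_smul {Ω : Set (Space d)} {V : Type} [NormedAddCommGroup V]
    [NormedSpace ℝ V] {f : Space d → V} (hf : MemLp f 2 (volume.restrict Ω))
    {η : Space d → ℝ} (hc : Continuous η) (hs : HasCompactSupport η) :
    Integrable (fun x => η x • f x) (volume.restrict Ω) := by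
  have h1 : MemLp η 2 (volume.restrict Ω) :=
    (hc.memLp_of_hasCompactSupport hs (μ := (volume : Measure (Space d))) (p := 2)).restrict Ω
  exact memLp_one_iff_integrable.1 (hf.smul h1)

lemma continuous_dirDeriv {η : Space d → ℝ} (hη : ContDiff ℝ ∞ η) (e : Space d) :
    Continuous (fun x => fderiv ℝ η x e) :=
  (hη.continuous_fderiv (by simp)).clm_apply continuous_const

lemma compactSupport_dirDeriv {η : Space d → ℝ} (hη : HasCompactSupport η) (e : Space d) :
    HasCompactSupport (fun x => fderiv ℝ η x e) :=
  hη.fderiv_apply ℝ e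

lemma memLp_clm_apply {Ω : Set (Space d)} {V : Type} [NormedAddCommGroup V]
    [NormedSpace ℝ V] {g : Space d → (Space d →L[ℝ] V)} (hg : MemLp g 2 (volume.restrict Ω))
    (e : Space d) : MemLp (fun x => g x e) 2 (volume.restrict Ω) :=
  (ContinuousLinearMap.apply ℝ V e).comp_memLp' hg

lemma IsWeakFDeriv.zero (Ω : Set (Space d)) {V : Type} [NormedAddCommGroup V]
    [NormedSpace ℝ V] : IsWeakFDeriv Ω (0 : Space d → V) 0 := by
  intro η _ _ _ e
  simp

lemma IsWeakFDeriv.add {Ω : Set (Space d)} {V : Type} [NormedAddCommGroup V]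
    [NormedSpace ℝ V] {f f' : Space d → V} {g g' : Space d → (Space d →L[ℝ] V)}
    (hf : MemLp f 2 (volume.restrict Ω)) (hf' : MemLp f' 2 (volume.restrict Ω))
    (hg : MemLp g 2 (volume.restrict Ω)) (hg' : MemLp g' 2 (volume.restrict Ω))
    (h : IsWeakFDeriv Ω f g) (h' : IsWeakFDeriv Ω f' g') :
    IsWeakFDeriv Ω (f + f') (g + g') := by
  intro η h1 h2 h3 e
  have c1 := continuous_dirDeriv h1 e
  have c2 := compactSupport_dirDeriv h2 e
  simp only [Pi.add_apply, _root_.add_apply, smul_add]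
  rw [integral_add (integrable_test_smul hf c1 c2) (integrable_test_smul hf' c1 c2),
    integral_add (integrable_test_smul (memLp_clm_apply hg e) h1.continuous h2)
      (integrable_test_smul (memLp_clm_apply hg' e) h1.continuous h2),
    h η h1 h2 h3 e, h' η h1 h2 h3 e]
  abel

lemma IsWeakFDeriv.smul {Ω : Set (Space d)} {V : Type} [NormedAddCommGroup V]
    [NormedSpace ℝ V] {f : Space d → V} {g : Space d → (Space d →L[ℝ] V)}
    (c : ℝ) (h : IsWeakFDeriv Ω f g) : IsWeakFDeriv Ω (c • f) (c • g) := by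
  intro η h1 h2 h3 e
  simp only [Pi.smul_apply, _root_.smul_apply]
  simp_rw [smul_comm _ c]
  rw [integral_smul, integral_smul, h η h1 h2 h3 e, smul_neg]

lemma IsWeakGrad.zero (Ω : Set (Space d)) : IsWeakGrad Ω 0 0 := by
  have := IsWeakFDeriv.zero Ω (V := ℝ)
  refine this.congr (EventuallyEq.refl _ _) (Eventually.of_forall fun x => ?_)
  simp

lemma IsWeakGrad.congr {Ω : Set (Space d)} {f f' : Space d → ℝ} {g g' : Space d → Space d}
    (h : IsWeakGrad Ω f g) (hf : f' =ᵐ[volume.restrict Ω] f)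
    (hg : g' =ᵐ[volume.restrict Ω] g) : IsWeakGrad Ω f' g' :=
  IsWeakFDeriv.congr h hf (by filter_upwards [hg] with x hx; rw [hx])

lemma IsWeakGrad.add {Ω : Set (Space d)} {f f' : Space d → ℝ} {g g' : Space d → Space d}
    (hf : MemLp f 2 (volume.restrict Ω)) (hf' : MemLp f' 2 (volume.restrict Ω))
    (hg : MemLp g 2 (volume.restrict Ω)) (hg' : MemLp g' 2 (volume.restrict Ω))
    (h : IsWeakGrad Ω f g) (h' : IsWeakGrad Ω f' g') : IsWeakGrad Ω (f + f') (g + g') := by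
  have := IsWeakFDeriv.add hf hf' ((innerSL ℝ (E := Space d)).comp_memLp' hg)
    ((innerSL ℝ (E := Space d)).comp_memLp' hg') h h'
  refine this.congr (EventuallyEq.refl _ _) (Eventually.of_forall fun x => ?_)
  simp

lemma IsWeakGrad.smul {Ω : Set (Space d)} {f : Space d → ℝ} {g : Space d → Space d}
    (c : ℝ) (h : IsWeakGrad Ω f g) : IsWeakGrad Ω (c • f) (c • g) := by
  have := IsWeakFDeriv.smul c h
  refine this.congr (EventuallyEq.refl _ _) (Eventually.of_forall fun x => ?_)
  simp

/-- The pairs `(φ, ∇φ)` with `φ ∈ H^1(Ω)` and `∫_Ω φ dx = 0`. (Integrability is automatic for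
bounded `Ω`.) -/
def Hav1Submodule (Ω : Set (Space d)) :
    Submodule ℝ (LpOn Ω ℝ 2 × LpOn Ω (Space d) 2) where
  carrier := {q | IsWeakGrad Ω q.1 q.2 ∧ IntegrableOn q.1 Ω ∧ ∫ x in Ω, q.1 x = 0}
  zero_mem' := by
    have h1 := Lp.coeFn_zero ℝ 2 ((volume : Measure (Space d)).restrict Ω)
    have h2 := Lp.coeFn_zero (Space d) 2 ((volume : Measure (Space d)).restrict Ω)
    refine ⟨(IsWeakGrad.zero Ω).congr h1 h2, ?_, ?_⟩
    · exact (integrable_zero _ _ _).congr h1.symm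
    · exact (integral_congr_ae h1).trans (by simp)
  add_mem' := by
    rintro ⟨a, a'⟩ ⟨b, b'⟩ ⟨ha, hai, ha0⟩ ⟨hb, hbi, hb0⟩
    refine ⟨(ha.add (Lp.memLp _) (Lp.memLp _) (Lp.memLp _) (Lp.memLp _) hb).congr
      (Lp.coeFn_add a b) (Lp.coeFn_add a' b'),
      (hai.add hbi).congr (Lp.coeFn_add a b).symm, ?_⟩
    refine (integral_congr_ae (Lp.coeFn_add a b)).trans ?_
    simp only [Pi.add_apply]
    rw [integral_add hai hbi]
    simp only at ha0 hb0
    rw [ha0, hb0, add_zero]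
  smul_mem' := by
    rintro c ⟨a, a'⟩ ⟨ha, hai, ha0⟩
    refine ⟨(ha.smul c).congr (Lp.coeFn_smul c a) (Lp.coeFn_smul c a'),
      (hai.smul c).congr (Lp.coeFn_smul c a).symm, ?_⟩
    refine (integral_congr_ae (Lp.coeFn_smul c a)).trans ?_
    simp only [Pi.smul_apply]
    rw [integral_smul]
    simp only at ha0
    rw [ha0, smul_zero]

/-- The space `H^1_av(Ω)` of mean-free `H^1(Ω)` functions, which carries the inner product
`(φ, ψ) = ∫_Ω ∇φ · ∇ψ dx` (see the instances below). -/
def Hav1 (Ω : Set (Space d)) : Type := ↥(Hav1Submodule Ω)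

instance (Ω : Set (Space d)) : AddCommGroup (Hav1 Ω) :=
  inferInstanceAs (AddCommGroup ↥(Hav1Submodule Ω))

instance (Ω : Set (Space d)) : Module ℝ (Hav1 Ω) :=
  inferInstanceAs (Module ℝ ↥(Hav1Submodule Ω))

/-- The `L^2` function underlying an element of `H^1_av(Ω)`. -/
def Hav1.fn {Ω : Set (Space d)} : Hav1 Ω →ₗ[ℝ] LpOn Ω ℝ 2 :=
  (LinearMap.fst ℝ _ _).comp (Hav1Submodule Ω).subtype

/-- The weak gradient of an element of `H^1_av(Ω)`. -/
def Hav1.grad {Ω : Set (Space d)} : Hav1 Ω →ₗ[ℝ] LpOn Ω (Space d) 2 :=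
  (LinearMap.snd ℝ _ _).comp (Hav1Submodule Ω).subtype

/-- `‖φ‖ = ‖∇φ‖_{L²(Ω)}`. It is definite for connected `Ω`. -/
instance (Ω : Set (Space d)) : SeminormedAddCommGroup (Hav1 Ω) :=
  SeminormedAddCommGroup.induced (Hav1 Ω) (LpOn Ω (Space d) 2) Hav1.grad

/-- `(φ, ψ) = ∫_Ω ∇φ · ∇ψ dx`. -/
instance (Ω : Set (Space d)) : InnerProductSpace ℝ (Hav1 Ω) where
  toNormedSpace := NormedSpace.induced ℝ (Hav1 Ω) (LpOn Ω (Space d) 2) Hav1.grad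
  inner φ ψ := ⟪Hav1.grad φ, Hav1.grad ψ⟫_ℝ
  norm_sq_eq_re_inner φ := norm_sq_eq_re_inner (𝕜 := ℝ) (Hav1.grad φ)
  conj_inner_symm φ ψ := inner_conj_symm (𝕜 := ℝ) (Hav1.grad φ) (Hav1.grad ψ)
  add_left φ ψ χ := by
    change ⟪Hav1.grad (φ + ψ), Hav1.grad χ⟫_ℝ = _
    rw [map_add, inner_add_left]
  smul_left φ ψ r := by
    change ⟪Hav1.grad (r • φ), Hav1.grad ψ⟫_ℝ = _
    rw [map_smul, inner_smul_left]

/-- `H^2(Ω)`, as the space of triples `(φ, ∇φ, ∇²φ)` of a function with its weak derivatives, all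
in `L^2(Ω)`; it carries the (maximum) norm of the product, equivalent to the usual norm. -/
def H2 (Ω : Set (Space d)) :
    Submodule ℝ (LpOn Ω ℝ 2 × LpOn Ω (Space d) 2 × LpOn Ω (Space d →L[ℝ] Space d) 2) where
  carrier := {q | IsWeakGrad Ω q.1 q.2.1 ∧ IsWeakFDeriv Ω q.2.1 q.2.2}
  zero_mem' := by
    have h1 := Lp.coeFn_zero ℝ 2 ((volume : Measure (Space d)).restrict Ω)
    have h2 := Lp.coeFn_zero (Space d) 2 ((volume : Measure (Space d)).restrict Ω)
    have h3 := Lp.coeFn_zero (Space d →L[ℝ] Space d) 2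
      ((volume : Measure (Space d)).restrict Ω)
    exact ⟨(IsWeakGrad.zero Ω).congr h1 h2, (IsWeakFDeriv.zero Ω).congr h2 h3⟩
  add_mem' := by
    rintro ⟨a, a', a''⟩ ⟨b, b', b''⟩ ⟨ha, ha'⟩ ⟨hb, hb'⟩
    exact ⟨(ha.add (Lp.memLp _) (Lp.memLp _) (Lp.memLp _) (Lp.memLp _) hb).congr
        (Lp.coeFn_add a b) (Lp.coeFn_add a' b'),
      (ha'.add (Lp.memLp _) (Lp.memLp _) (Lp.memLp _) (Lp.memLp _) hb').congr
        (Lp.coeFn_add a' b') (Lp.coeFn_add a'' b'')⟩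
  smul_mem' := by
    rintro c ⟨a, a', a''⟩ ⟨ha, ha'⟩
    exact ⟨(ha.smul c).congr (Lp.coeFn_smul c a) (Lp.coeFn_smul c a'),
      (ha'.smul c).congr (Lp.coeFn_smul c a') (Lp.coeFn_smul c a'')⟩

/-! ### The spaces `H`, `H^*` and the affine state space -/

/-- The dual of `H^1_av(Ω)`, with the dual norm. -/
abbrev Hav1Dual (Ω : Set (Space d)) : Type := StrongDual ℝ (Hav1 Ω)

/-- The dual norm is definite. -/
instance (Ω : Set (Space d)) : NormedAddCommGroup (Hav1Dual Ω) :=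
  NormedAddCommGroup.ofSeparation fun w hw => by
    ext ψ
    have h := w.le_opNorm ψ
    rw [hw, zero_mul] at h
    exact norm_le_zero_iff.1 h

/-- The Hilbert space `H = (H^1_av(Ω))' × L^2(Ω)`.

For `m : ℝ`, the affine state space `H_m`, the set of all pairs `(u, z)` with `u - m` in
`(H^1_av(Ω))'` and `z ∈ L^2(Ω)`, is parametrised by `H`: the element `(w, z)` of `H` stands for the
state `(m + w, z)` of `H_m`. -/
abbrev H (Ω : Set (Space d)) : Type := WithLp 2 (Hav1Dual Ω × LpOn Ω ℝ 2)

/-- `H^* = H^1_av(Ω) × L^2(Ω)`. -/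
abbrev HStar (Ω : Set (Space d)) : Type := WithLp 2 (Hav1 Ω × LpOn Ω ℝ 2)

/-- The duality pairing `⟨(μ, ξ), (v, y)⟩ = ⟨v, μ⟩ + ∫_Ω ξ y dx` of `H^*` and `H`. -/
def pairing {Ω : Set (Space d)} (μ : HStar Ω) (v : H Ω) : ℝ :=
  v.fst μ.fst + ⟪μ.snd, v.snd⟫_ℝ

/-- The functional `w ∈ (H^1_av(Ω))'` is the mean-free function `f ∈ L^2(Ω)`, that is,
`⟨w, ψ⟩ = ∫_Ω f ψ dx` for all `ψ`. Such an `f` is unique. -/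
def Represents {Ω : Set (Space d)} (w : Hav1Dual Ω) (f : LpOn Ω ℝ 2) : Prop :=
  IntegrableOn f Ω ∧ ∫ x in Ω, f x = 0 ∧ ∀ ψ : Hav1 Ω, w ψ = ⟪f, Hav1.fn ψ⟫_ℝ

/-! ### The energy and its Gateaux subdifferential -/

open Classical in
/-- `∫_Ω (½|g|² + F(u) + ½(z - K(u))²) dx`, for `L^2` functions `u, g, z`. For `F'' ≥ -β`, bounded
`Ω` and `K` Lipschitz everything in the integrand but the positive part of `F(u)` is integrable, so
that the integral has a value in `(-∞, ∞]`, which is `∞` exactly if `F(u)` is not integrable. -/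
def energyIntegral (Ω : Set (Space d)) (F K : ℝ → ℝ) (u : Space d → ℝ) (g : Space d → Space d)
    (z : Space d → ℝ) : EReal :=
  if IntegrableOn (fun x => F (u x)) Ω then
    ((∫ x in Ω, ((1 / 2 * ‖g x‖ ^ 2 + F (u x)) + 1 / 2 * (z x - K (u x)) ^ 2) : ℝ) : EReal)
  else ⊤

/-- The energy `E(m + w, z)`: if `w` is given by a (unique) function `φ ∈ H^1_av(Ω)`, it is
`∫_Ω (½|∇u|² + F(u) + ½(z - K(u))²) dx` with `u = m + φ`; if there is no such function (the infimum
is over the empty set), it is `+∞`. -/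
def energy (Ω : Set (Space d)) (F K : ℝ → ℝ) (m : ℝ) (v : H Ω) : EReal :=
  ⨅ (φ : Hav1 Ω) (_ : Represents v.fst (Hav1.fn φ)),
    energyIntegral Ω F K (fun x => m + Hav1.fn φ x) (Hav1.grad φ) v.snd

/-- The Gateaux subdifferential of a functional `J` on (the affine space over) `H` at a point `u` of
the domain of `J`: all `μ ∈ H^*` with `liminf_{t ↘ 0} (J(u + t v) - J(u)) / t ≥ ⟨μ, v⟩` for all `v`.
It is empty outside the domain. -/
def gateauxSubdiff {Ω : Set (Space d)} (J : H Ω → EReal) (u : H Ω) : Set (HStar Ω) :=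
  {μ | J u ≠ ⊤ ∧ ∀ v : H Ω,
    ((pairing μ v : ℝ) : EReal) ≤
      liminf (fun t : ℝ => (J (u + t • v) - J u) / (t : EReal)) (𝓝[>] 0)}

/-! ### Curves -/

/-- `AC²([0,T]; X)`: absolutely continuous on `[0,T]`, with (a.e. existing) derivative in
`L²(0,T; X)`. -/
def IsAC2 {X : Type} [NormedAddCommGroup X] [NormedSpace ℝ X] (T : ℝ) (u : ℝ → X) : Prop :=
  AbsolutelyContinuousOnInterval u 0 T ∧
  (∀ᵐ t ∂(volume.restrict (Ioo 0 T)), DifferentiableAt ℝ u t) ∧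
  MemLp (deriv u) 2 (volume.restrict (Ioo 0 T))

/-- The curve of states `(m + w(t), z(t))`, with `(w(t), z(t)) = v t`, is in the Bochner space
`L²(0,T; H²(Ω) × L^∞(Ω))`. (As constants are in `H²(Ω)`, it is the same to ask this of `m + w` or
of `w`.) -/
def MemL2H2Linf {Ω : Set (Space d)} (T : ℝ) (v : ℝ → H Ω) : Prop :=
  (∃ U : ℝ → H2 Ω, MemLp U 2 (volume.restrict (Ioo 0 T)) ∧
    ∀ᵐ t ∂(volume.restrict (Ioo 0 T)), Represents (v t).fst (U t).1.1) ∧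
  (∃ ζ : ℝ → LpOn Ω ℝ ∞, MemLp ζ 2 (volume.restrict (Ioo 0 T)) ∧
    ∀ᵐ t ∂(volume.restrict (Ioo 0 T)), ζ t =ᵐ[volume.restrict Ω] (v t).snd)

end PhaseSep

end

open PhaseSep

/-!
The energy is, up to a controlled quadratic error, convex along the curve, and this turns the
subdifferential into a two-point inequality from which everything follows.

Let `μ ∈ ∂_G E(v)` and let `v'` be another state of finite energy, with `h = u' - u` the difference
of the first components. Along the segment from `v` to `v'` one has, with `M` a bound for
`|z - K(u)|`, `L` a Lipschitz constant of `A = K'` and `F'' ≥ -β`,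
`E(v + s (v' - v)) ≤ (1 - s) E(v) + s E(v') - s/2 ‖∇h‖² + s (β/2 + M L) ‖h‖²_{L²} + O(s²)`
(`energyReal_segment_le`). As `‖h‖²_{L²}` is the value at `h` of the functional that `h` represents,
it is at most `‖v' - v‖ ‖∇h‖`. Dividing by `s` and letting `s → 0` in the definition of `∂_G E`
gives `E(v) + ⟨μ, v' - v⟩ + ‖∇h‖²/4 ≤ E(v') + λ ‖v' - v‖²` with `λ = (β/2 + M L)²`
(`pairing_le_of_mem_gateauxSubdiff`). No formula for the subdifferential is needed.

The weight `λ` is integrable in time: `M` is bounded by the `L^∞` norm of `z` and, through the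
embedding of `H²` into `L^∞` for `d ≤ 3`, by the `H²` norm of `u`. The embedding
(`exists_ae_abs_le_norm_of_cone`) holds on every open set in which each point is joined by segments
to a ball of fixed radius at bounded distance: the Taylor formula with second-order remainder,
averaged over that ball, is applied to mollifications. Convex domains have this
property, and so do `C^{1,1}` domains, by local charts and compactness.

The inequality holds with base point at almost every time `t`. Combined with the `AC²` bound
`‖v s - v t‖² ≤ |s - t| ∫_s^t ‖v'‖²`, it controls the increments of `e = E ∘ v` between good times
by `|s - t| κ(t)`, with an integrable `κ`, and by increments of a fixed absolutely continuous
function. In dyadic intervals shrinking to an arbitrary time one chooses good times at which `κ` is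
at most its average. Telescoping (`chaining`) shows that the energies converge along them, and the
term `‖∇h‖²/4` that the states form a Cauchy sequence in `H^1_av`. Hence the limit has finite
energy, with lower semicontinuity (`energyReal_le_of_tendsto`), and `e` is absolutely continuous.
Finally, at almost every `t`, the function `s ↦ e s - ⟨μ t, v s - v t⟩ + λ(t) ‖v s - v t‖²` is
differentiable with a minimum at `t`, which identifies the derivative of `e`.
-/

namespace PhaseSep

/-! ### Absolutely continuous curves and a chaining lemma -/

lemma absolutelyContinuousOnInterval_of_dist_le {X Y : Type*} [PseudoMetricSpace X]
    [PseudoMetricSpace Y] {f : ℝ → X} {g : ℝ → Y} {a b C : ℝ}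
    (hg : AbsolutelyContinuousOnInterval g a b)
    (h : ∀ s ∈ uIcc a b, ∀ t ∈ uIcc a b, dist (f s) (f t) ≤ C * dist (g s) (g t)) :
    AbsolutelyContinuousOnInterval f a b := by
  unfold AbsolutelyContinuousOnInterval at hg ⊢
  have h2 := hg.const_mul C
  rw [mul_zero] at h2
  refine tendsto_of_tendsto_of_tendsto_of_le_of_le' tendsto_const_nhds h2
    (Eventually.of_forall fun E => Finset.sum_nonneg fun _ _ => dist_nonneg) ?_
  filter_upwards [mem_inf_of_right (mem_principal_self _)] with E hE
  rw [Finset.mul_sum]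
  exact Finset.sum_le_sum fun i hi => h _ (hE.1 i hi).1 _ (hE.1 i hi).2

lemma sq_integral_le {f : ℝ → ℝ} {s t : ℝ} (hst : s ≤ t)
    (hf : IntervalIntegrable f volume s t)
    (hf2 : IntervalIntegrable (fun r => f r ^ 2) volume s t) :
    (∫ r in s..t, f r) ^ 2 ≤ (t - s) * ∫ r in s..t, f r ^ 2 := by
  rcases hst.eq_or_lt with rfl | hlt
  · simp
  have hpos : 0 < t - s := sub_pos.2 hlt
  set c := (∫ r in s..t, f r) / (t - s) with hc
  have h0 : 0 ≤ ∫ r in s..t, (f r - c) ^ 2 :=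
    intervalIntegral.integral_nonneg hst fun _ _ => sq_nonneg _
  have h1 : ∫ r in s..t, (f r - c) ^ 2
      = (∫ r in s..t, f r ^ 2) - 2 * c * (∫ r in s..t, f r) + (t - s) * c ^ 2 := by
    have : ∀ r, (f r - c) ^ 2 = (f r ^ 2 - 2 * c * f r) + c ^ 2 := fun r => by ring
    simp_rw [this]
    rw [intervalIntegral.integral_add (hf2.sub (hf.const_mul _)) intervalIntegrable_const,
      intervalIntegral.integral_sub hf2 (hf.const_mul _), intervalIntegral.integral_const_mul,
      intervalIntegral.integral_const, smul_eq_mul]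
  have hI : ∫ r in s..t, f r = c * (t - s) := by rw [hc]; field_simp
  rw [h1, hI] at h0
  rw [hI]
  nlinarith

lemma IsAC2.intervalIntegrable_norm_sq {X : Type} [NormedAddCommGroup X] [NormedSpace ℝ X]
    {T : ℝ} (hT : 0 ≤ T) {v : ℝ → X} (hv : IsAC2 T v) :
    IntervalIntegrable (fun r => ‖deriv v r‖ ^ 2) volume 0 T := by
  rw [intervalIntegrable_iff_integrableOn_Ioo_of_le hT]
  exact hv.2.2.integrable_norm_pow (p := 2) (by norm_num)

/-- A curve in `AC²` obeys the fundamental theorem of calculus after application of any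
functional, whence the Hölder-type estimate. -/
lemma IsAC2.norm_sub_sq_le {X : Type} [NormedAddCommGroup X] [NormedSpace ℝ X]
    {T : ℝ} {v : ℝ → X} (hv : IsAC2 T v) {s t : ℝ} (hs : 0 ≤ s) (hst : s ≤ t) (ht : t ≤ T) :
    ‖v t - v s‖ ^ 2 ≤ (t - s) * ∫ r in s..t, ‖deriv v r‖ ^ 2 := by
  have hT : 0 ≤ T := hs.trans (hst.trans ht)
  have hsub : uIcc s t ⊆ uIcc 0 T := by
    rw [uIcc_of_le hst, uIcc_of_le hT]; exact Icc_subset_Icc hs ht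
  have i2 := (hv.intervalIntegrable_norm_sq hT).mono_set hsub
  have i1 : IntervalIntegrable (fun r => ‖deriv v r‖) volume s t := by
    refine IntervalIntegrable.mono_set ?_ hsub
    rw [intervalIntegrable_iff_integrableOn_Ioo_of_le hT]
    exact (hv.2.2.integrable (by norm_num)).norm
  refine le_trans ?_ (sq_integral_le hst i1 i2)
  have i0 : 0 ≤ ∫ r in s..t, ‖deriv v r‖ :=
    intervalIntegral.integral_nonneg hst fun _ _ => norm_nonneg _
  have hmain : ‖v t - v s‖ ≤ ∫ r in s..t, ‖deriv v r‖ := by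
    refine NormedSpace.norm_le_dual_bound ℝ _ i0 fun ℓ => ?_
    have hac : AbsolutelyContinuousOnInterval (fun r => ℓ (v r)) s t :=
      absolutelyContinuousOnInterval_of_dist_le (C := ‖ℓ‖) (hv.1.mono hsub) fun a _ b _ => by
        rw [dist_eq_norm, dist_eq_norm, ← map_sub]; exact ℓ.le_opNorm _
    have hftc := hac.integral_deriv_eq_sub
    rw [map_sub, ← hftc]
    have hd : ∀ᵐ r ∂volume, r ∈ Ioc s t → ‖deriv (fun r => ℓ (v r)) r‖ ≤ ‖deriv v r‖ * ‖ℓ‖ := by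
      have h1 : ∀ᵐ r ∂volume, r ∈ Ioo 0 T → DifferentiableAt ℝ v r :=
        (ae_restrict_iff' measurableSet_Ioo).1 hv.2.1
      have h2 : ∀ᵐ r ∂volume, r ≠ t := by simp [ae_iff, measure_singleton]
      filter_upwards [h1, h2] with r hr hrt hmem
      have hr' := hr ⟨hs.trans_lt hmem.1, (lt_of_le_of_ne hmem.2 hrt).trans_le ht⟩
      have := (ℓ.hasFDerivAt.comp_hasDerivAt r hr'.hasDerivAt).deriv
      rw [show deriv (fun r => ℓ (v r)) r = ℓ (deriv v r) from this, mul_comm]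
      exact ℓ.le_opNorm _
    rw [← intervalIntegral.integral_mul_const]
    exact intervalIntegral.norm_integral_le_of_norm_le hst hd (i1.mul_const _)
  exact pow_le_pow_left₀ (norm_nonneg _) hmain 2

/-- One-sided chaining. At every good time `t ∈ G` the function `f` satisfies the lower bound `low`
with respect to all times `s` at which it is defined (`P s`), with a defect controlled by the
increments of a monotone function `I`. Comparing `f` at good times `c j` chosen in the dyadic
intervals `[a + ℓ / 2 ^ (j + 1), a + ℓ / 2 ^ j]` shows that `f (c j)` is a Cauchy sequence, and
`closed` then transfers the estimate to `a` itself. -/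
lemma chaining_left {P : ℝ → Prop} {f κ I : ℝ → ℝ} {ρ : ℝ → ℝ → ℝ} {G : Set ℝ} {a b : ℝ}
    (hab : a < b) (hI : MonotoneOn I (Icc a b)) (hIc : ContinuousWithinAt I (Icc a b) a)
    (hκ : ∀ t, 0 ≤ κ t) (hρ : ∀ s t, 0 ≤ ρ s t)
    (sel : ∀ α ∈ Icc a b, ∀ β ∈ Icc a b, α < β →
      ∃ c ∈ G, c ∈ Icc α β ∧ (β - α) * κ c ≤ I β - I α)
    (hP : ∀ t ∈ G, P t)
    (low : ∀ t ∈ G, t ∈ Icc a b → ∀ s ∈ Icc a b, P s →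
      f t + ρ s t ≤ f s + |s - t| * κ t + |I s - I t|)
    (closed : ∀ (c : ℕ → ℝ) (y : ℝ), (∀ n, c n ∈ G) → Tendsto c atTop (𝓝 a) →
      Tendsto (fun n => f (c n)) atTop (𝓝 y) →
      (∀ ε > 0, ∃ N, ∀ j ≥ N, ∀ i ≥ j, ρ (c i) (c j) ≤ ε) → (∀ n, c n ∈ Icc a b) →
      P a ∧ f a ≤ y) :
    P a ∧ ∃ c ∈ G, c ∈ Icc a b ∧ (b - a) * κ c ≤ 2 * (I b - I a) ∧
      |f c - f a| ≤ 8 * (I b - I a) := by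
  set ℓ := b - a with hℓ
  have hℓ0 : 0 < ℓ := sub_pos.2 hab
  set x : ℕ → ℝ := fun j => a + ℓ * (1 / 2) ^ j with hx
  have hxs : ∀ j, x (j + 1) = a + (x j - a) / 2 := fun j => by
    simp only [hx, pow_succ]; ring
  have hxa : ∀ j, a < x j := fun j => by
    simp only [hx]
    linarith [show 0 < ℓ * (1 / 2) ^ j by positivity]
  have hx0 : x 0 = b := by simp [hx, hℓ]
  have hxb : ∀ j, x j ≤ b := by
    intro j
    induction j with
    | zero => exact hx0.le
    | succ k ih => rw [hxs]; linarith [hxa k]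
  have hxm : ∀ j, x j ∈ Icc a b := fun j => ⟨(hxa j).le, hxb j⟩
  have hxlt : ∀ j, x (j + 1) < x j := fun j => by rw [hxs]; linarith [hxa j]
  have ham : a ∈ Icc a b := ⟨le_rfl, hab.le⟩
  have hxt : Tendsto x atTop (𝓝 a) := by
    have := (tendsto_pow_atTop_nhds_zero_of_lt_one (r := (1 / 2 : ℝ)) (by norm_num)
      (by norm_num)).const_mul ℓ
    simpa [hx] using this.const_add a
  choose c hcG hcm hcκ using fun j => sel (x (j + 1)) (hxm _) (x j) (hxm _) (hxlt j)
  have hcab : ∀ j, c j ∈ Icc a b := fun j =>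
    ⟨(hxa _).le.trans (hcm j).1, (hcm j).2.trans (hxb j)⟩
  have hct : Tendsto c atTop (𝓝 a) :=
    tendsto_of_tendsto_of_tendsto_of_le_of_le tendsto_const_nhds hxt
      (fun j => (hcab j).1) (fun j => (hcm j).2)
  have hIt : Tendsto (fun j => I (x j)) atTop (𝓝 (I a)) :=
    hIc.tendsto.comp (tendsto_nhdsWithin_iff.2 ⟨hxt, Eventually.of_forall hxm⟩)
  have hIx : ∀ j, I a ≤ I (x j) := fun j => hI ham (hxm j) (hxa j).le
  have hIs : ∀ j, I (x (j + 1)) ≤ I (x j) := fun j => hI (hxm _) (hxm j) (hxlt j).le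
  have hIc1 : ∀ j, I (c j) ≤ I (x j) := fun j => hI (hcab j) (hxm j) (hcm j).2
  have hIc2 : ∀ j, I (x (j + 1)) ≤ I (c j) := fun j => hI (hxm _) (hcab j) (hcm j).1
  have hκx : ∀ j, (x j - a) * κ (c j) ≤ 2 * (I (x j) - I (x (j + 1))) := fun j => by
    have := hcκ j
    rw [hxs] at this
    have h2 : x j - (a + (x j - a) / 2) = (x j - a) / 2 := by ring
    rw [h2] at this
    rw [hxs]
    linarith
  -- Comparison of consecutive good times; the gap is at most `x j - a`.
  have hstep : ∀ j, |f (c j) - f (c (j + 1))| ≤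
      4 * ((I (x j) + I (x (j + 1))) - (I (x (j + 1)) + I (x (j + 1 + 1)))) := by
    intro j
    have hcc : c (j + 1) ≤ c j := (hcm (j + 1)).2.trans (hcm j).1
    have h1 := low _ (hcG j) (hcab j) _ (hcab (j + 1)) (hP _ (hcG _))
    have h2 := low _ (hcG (j + 1)) (hcab (j + 1)) _ (hcab j) (hP _ (hcG _))
    have e1 : |I (c (j + 1)) - I (c j)| ≤ I (x j) - I (x (j + 1 + 1)) := by
      rw [abs_le]; constructor <;> linarith [hIc1 j, hIc2 (j + 1), hIc1 (j + 1), hIc2 j, hIs j]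
    have e2 : |c (j + 1) - c j| ≤ 3 / 4 * (x j - a) := by
      rw [abs_sub_comm, abs_of_nonneg (by linarith)]
      have := (hcm j).2
      have h3 := (hcm (j + 1)).1
      rw [hxs, hxs] at h3
      linarith
    have e3 : |c (j + 1) - c j| * κ (c j) ≤ 3 / 2 * (I (x j) - I (x (j + 1))) := by
      have := mul_le_mul_of_nonneg_right e2 (hκ (c j))
      linarith [hκx j]
    have e4 : |c j - c (j + 1)| * κ (c (j + 1)) ≤ 3 * (I (x (j + 1)) - I (x (j + 1 + 1))) := by
      rw [abs_sub_comm]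
      have e5 : |c (j + 1) - c j| ≤ 3 / 2 * (x (j + 1) - a) := by rw [hxs]; linarith
      have := mul_le_mul_of_nonneg_right e5 (hκ (c (j + 1)))
      linarith [hκx (j + 1)]
    have r1 := hρ (c (j + 1)) (c j)
    have r2 := hρ (c j) (c (j + 1))
    rw [abs_sub_comm (I (c j))] at h2
    rw [abs_le]
    constructor <;> linarith [hIs j, hIs (j + 1)]
  set S : ℕ → ℝ := fun j => I (x j) + I (x (j + 1)) with hS
  have hSt : Tendsto S atTop (𝓝 (I a + I a)) := hIt.add (hIt.comp (tendsto_add_atTop_nat 1))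
  have hSa : ∀ j, I a + I a ≤ S j := fun j => add_le_add (hIx j) (hIx (j + 1))
  have hchain : ∀ n k, |f (c n) - f (c (n + k))| ≤ 4 * (S n - S (n + k)) := by
    intro n k
    induction k with
    | zero => simp
    | succ k ih =>
      have h1 := hstep (n + k)
      have h2 := abs_sub_le (f (c n)) (f (c (n + k))) (f (c (n + k + 1)))
      have h3 : S (n + (k + 1)) = I (x (n + k + 1)) + I (x (n + k + 1 + 1)) := rfl
      have h4 : S (n + k) = I (x (n + k)) + I (x (n + k + 1)) := rfl
      rw [← add_assoc] at *
      linarith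
  have hchain' : ∀ n m, n ≤ m → |f (c n) - f (c m)| ≤ 4 * (S n - (I a + I a)) := by
    intro n m hnm
    obtain ⟨k, rfl⟩ := Nat.exists_eq_add_of_le hnm
    linarith [hchain n k, hSa (n + k)]
  have hSt0 : Tendsto (fun n => 4 * (S n - (I a + I a))) atTop (𝓝 0) := by
    simpa using (hSt.sub_const (I a + I a)).const_mul 4
  have hcau : CauchySeq (fun n => f (c n)) :=
    cauchySeq_of_le_tendsto_0' _ (fun n m hnm => by
      rw [Real.dist_eq]; exact hchain' n m hnm) hSt0
  obtain ⟨y, hy⟩ := cauchySeq_tendsto_of_complete hcau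
  -- The defect of `c j` against any time in `[a, c j]` tends to zero.
  have hdef : ∀ j, ∀ s ∈ Icc a (c j),
      |s - c j| * κ (c j) + |I s - I (c j)| ≤ 3 * (I (x j) - I a) := by
    intro j s hs
    have hsab : s ∈ Icc a b := ⟨hs.1, hs.2.trans (hcab j).2⟩
    have e1 : |s - c j| ≤ x j - a := by
      rw [abs_sub_comm, abs_of_nonneg (by linarith [hs.2])]
      linarith [hs.1, (hcm j).2]
    have e2 := mul_le_mul_of_nonneg_right e1 (hκ (c j))
    have e3 : |I s - I (c j)| ≤ I (x j) - I a := by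
      rw [abs_sub_comm, abs_of_nonneg (sub_nonneg.2 (hI hsab (hcab j) hs.2))]
      linarith [hI ham hsab hs.1, hIc1 j]
    linarith [hκx j, hIx (j + 1)]
  have hmono : ∀ j i, j ≤ i → c i ≤ c j := by
    intro j i hji
    have : Antitone c := antitone_nat_of_succ_le fun n => (hcm (n + 1)).2.trans (hcm n).1
    exact this hji
  have hρt : ∀ ε > 0, ∃ N, ∀ j ≥ N, ∀ i ≥ j, ρ (c i) (c j) ≤ ε := by
    intro ε hε
    have ht : Tendsto (fun n => 4 * (S n - (I a + I a)) + 3 * (I (x n) - I a)) atTop (𝓝 0) := by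
      simpa using hSt0.add ((hIt.sub_const (I a)).const_mul 3)
    obtain ⟨N, hN⟩ := eventually_atTop.1 (ht.eventually (gt_mem_nhds hε))
    refine ⟨N, fun j hj i hij => ?_⟩
    have h1 := low _ (hcG j) (hcab j) _ (hcab i) (hP _ (hcG i))
    have h2 := hdef j (c i) ⟨(hcab i).1, hmono j i hij⟩
    have h3 := (abs_le.1 (hchain' j i hij)).1
    linarith [hN j hj]
  obtain ⟨hPa, hfa⟩ := closed c y hcG hct hy hρt hcab
  have hfa' : y ≤ f a := by
    have ht : Tendsto (fun n => f a + 3 * (I (x n) - I a)) atTop (𝓝 (f a)) := by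
      simpa using ((hIt.sub_const (I a)).const_mul 3).const_add (f a)
    refine le_of_tendsto_of_tendsto' hy ht fun n => ?_
    have h1 := low _ (hcG n) (hcab n) a ham hPa
    have h2 := hdef n a ⟨le_rfl, (hcab n).1⟩
    linarith [hρ a (c n)]
  have hya : y = f a := le_antisymm hfa' hfa
  refine ⟨hPa, c 0, hcG 0, hcab 0, ?_, ?_⟩
  · have := hκx 0
    rw [hx0] at this
    linarith [hIx 1]
  · have h1 : |f (c 0) - y| ≤ 4 * (S 0 - (I a + I a)) :=
      le_of_tendsto ((hy.const_sub _).abs) (Eventually.of_forall fun m => hchain' 0 m m.zero_le)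
    rw [hya] at h1
    have h2 : S 0 ≤ I b + I b := by
      simp only [hS, hx0]
      have := hIs 0
      rw [hx0] at this
      linarith
    linarith

/-- Chaining from both ends of an interval: `f` is defined everywhere on `[0, T]` and its increments
are controlled by those of `I`. -/
lemma chaining {P : ℝ → Prop} {f κ I : ℝ → ℝ} {ρ : ℝ → ℝ → ℝ} {G : Set ℝ} {T : ℝ}
    (hT : 0 < T) (hI : MonotoneOn I (Icc 0 T)) (hIc : ContinuousOn I (Icc 0 T))
    (hκ : ∀ t, 0 ≤ κ t) (hρ : ∀ s t, 0 ≤ ρ s t)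
    (sel : ∀ α ∈ Icc 0 T, ∀ β ∈ Icc 0 T, α < β →
      ∃ c ∈ G, c ∈ Icc α β ∧ (β - α) * κ c ≤ I β - I α)
    (hP : ∀ t ∈ G, P t)
    (low : ∀ t ∈ G, t ∈ Icc 0 T → ∀ s ∈ Icc 0 T, P s →
      f t + ρ s t ≤ f s + |s - t| * κ t + |I s - I t|)
    (closed : ∀ a ∈ Icc 0 T, ∀ (c : ℕ → ℝ) (y : ℝ), (∀ n, c n ∈ G) → Tendsto c atTop (𝓝 a) →
      Tendsto (fun n => f (c n)) atTop (𝓝 y) →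
      (∀ ε > 0, ∃ N, ∀ j ≥ N, ∀ i ≥ j, ρ (c i) (c j) ≤ ε) → (∀ n, c n ∈ Icc 0 T) →
      P a ∧ f a ≤ y) :
    (∀ t ∈ Icc 0 T, P t) ∧
      ∀ s ∈ Icc 0 T, ∀ t ∈ Icc 0 T, |f s - f t| ≤ 19 * |I s - I t| := by
  have left : ∀ a ∈ Icc 0 T, ∀ b ∈ Icc 0 T, a < b →
      P a ∧ ∃ c ∈ G, c ∈ Icc a b ∧ (b - a) * κ c ≤ 2 * (I b - I a) ∧
        |f c - f a| ≤ 8 * (I b - I a) := by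
    intro a ha b hb hab
    have hsub : Icc a b ⊆ Icc 0 T := Icc_subset_Icc ha.1 hb.2
    exact chaining_left hab (hI.mono hsub) ((hIc a ha).mono hsub) hκ hρ
      (fun α hα β hβ => sel α (hsub hα) β (hsub hβ)) hP
      (fun t ht ht' s hs => low t ht (hsub ht') s (hsub hs))
      (fun c y h1 h2 h3 h4 h5 => closed a ha c y h1 h2 h3 h4 fun n => hsub (h5 n))
  have right : ∀ a ∈ Icc 0 T, ∀ b ∈ Icc 0 T, a < b →
      P b ∧ ∃ c ∈ G, c ∈ Icc a b ∧ (b - a) * κ c ≤ 2 * (I b - I a) ∧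
        |f c - f b| ≤ 8 * (I b - I a) := by
    intro a ha b hb hab
    have hsub : ∀ t, t ∈ Icc (-b) (-a) → -t ∈ Icc 0 T := fun t ht =>
      ⟨by linarith [ht.2, ha.1], by linarith [ht.1, hb.2]⟩
    have key := chaining_left (P := fun t => P (-t)) (f := fun t => f (-t))
      (κ := fun t => κ (-t)) (I := fun t => -I (-t)) (ρ := fun s t => ρ (-s) (-t))
      (G := {t | -t ∈ G}) (a := -b) (b := -a) (by linarith)
      (fun s hs t ht hst => neg_le_neg (hI (hsub t ht) (hsub s hs) (by linarith)))
      ((((hIc (-(-b)) (by simpa using hb)).comp continuous_neg.continuousWithinAt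
        (fun t ht => hsub t ht)).neg))
      (fun t => hκ _) (fun s t => hρ _ _)
      (fun α hα β hβ hαβ => by
        obtain ⟨c, hc, hcm, hcκ⟩ := sel (-β) (hsub β hβ) (-α) (hsub α hα) (by linarith)
        refine ⟨-c, by simpa using hc, ⟨by linarith [hcm.2], by linarith [hcm.1]⟩, ?_⟩
        simp only [neg_neg]
        linarith)
      (fun t ht => hP _ ht)
      (fun t ht ht' s hs hPs => by
        have := low (-t) ht (hsub t ht') (-s) (hsub s hs) hPs
        rw [show -s - -t = -(s - t) by ring, abs_neg] at this
        rw [show -I (-s) - -I (-t) = -(I (-s) - I (-t)) by ring, abs_neg]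
        exact this)
      (fun c y h1 h2 h3 h4 h5 => by
        have := closed b hb (fun n => -c n) y h1 (by simpa using h2.neg) h3 h4
          (fun n => hsub _ (h5 n))
        simpa using this)
    simp only [neg_neg] at key
    obtain ⟨h1, c, h2, h3, h4, h5⟩ := key
    refine ⟨h1, -c, h2, ⟨by linarith [h3.2], by linarith [h3.1]⟩, ?_, ?_⟩
    · linarith
    · linarith
  have main : ∀ s ∈ Icc 0 T, ∀ t ∈ Icc 0 T, s < t → |f s - f t| ≤ 19 * (I t - I s) := by
    intro s hs t ht hst
    obtain ⟨-, c, hcG, hcm, hcκ, hcf⟩ := left s hs t ht hst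
    obtain ⟨-, c', hcG', hcm', hcκ', hcf'⟩ := right s hs t ht hst
    have hsub : Icc s t ⊆ Icc 0 T := Icc_subset_Icc hs.1 ht.2
    have h1 := low c hcG (hsub hcm) c' (hsub hcm') (hP _ hcG')
    have h2 := low c' hcG' (hsub hcm') c (hsub hcm) (hP _ hcG)
    have e1 : |c' - c| ≤ t - s := by
      rw [abs_le]; constructor <;> linarith [hcm.1, hcm.2, hcm'.1, hcm'.2]
    have e2 : |I c' - I c| ≤ I t - I s := by
      have := hI hs (hsub hcm) hcm.1
      have := hI (hsub hcm) ht hcm.2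
      have := hI hs (hsub hcm') hcm'.1
      have := hI (hsub hcm') ht hcm'.2
      rw [abs_le]; constructor <;> linarith
    have e3 := mul_le_mul_of_nonneg_right e1 (hκ c)
    have e4 := mul_le_mul_of_nonneg_right e1 (hκ c')
    rw [abs_sub_comm c c', abs_sub_comm (I c) (I c')] at h2
    have r1 := hρ c' c
    have r2 := hρ c c'
    rw [abs_le] at hcf hcf' ⊢
    constructor <;> linarith [hcf.1, hcf.2, hcf'.1, hcf'.2]
  refine ⟨fun t ht => ?_, fun s hs t ht => ?_⟩
  · rcases eq_or_lt_of_le ht.2 with h | h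
    · exact (right 0 ⟨le_rfl, hT.le⟩ t ht (by rw [h]; exact hT)).1
    · exact (left t ht T ⟨hT.le, le_rfl⟩ h).1
  · rcases lt_trichotomy s t with h | h | h
    · rw [abs_sub_comm (I s), abs_of_nonneg (sub_nonneg.2 (hI hs ht h.le))]
      exact main s hs t ht h
    · simp [h]
    · rw [abs_sub_comm (f s), abs_of_nonneg (sub_nonneg.2 (hI ht hs h.le))]
      exact main t ht s hs h

/-! ### Scalar inequalities -/

lemma convexOn_add_sq {F : ℝ → ℝ} (hF : ContDiff ℝ 2 F) {β : ℝ}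
    (hFβ : ∀ s : ℝ, -β ≤ deriv (deriv F) s) :
    ConvexOn ℝ univ (fun s => F s + β / 2 * s ^ 2) := by
  have h1 : Differentiable ℝ F := hF.differentiable (by norm_num)
  have h2 : Differentiable ℝ (deriv F) :=
    (hF.iterate_deriv' 1 1).differentiable (by norm_num)
  have d1 : deriv (fun s => F s + β / 2 * s ^ 2) = fun s => deriv F s + β * s := by
    funext s
    have := (h1 s).hasDerivAt.fun_add (((hasDerivAt_id' s).fun_pow 2).const_mul (β / 2))
    rw [this.deriv]
    simp; ring
  have d2 : ∀ s, HasDerivAt (fun s => deriv F s + β * s) (deriv (deriv F) s + β) s := fun s => by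
    simpa using (h2 s).hasDerivAt.fun_add ((hasDerivAt_id' s).const_mul β)
  refine convexOn_univ_of_deriv2_nonneg (h1.add (by fun_prop)) ?_ fun s => ?_
  · rw [d1]; exact fun s => (d2 s).differentiableAt
  · simp only [Function.iterate_succ, Function.iterate_zero, Function.comp_apply, id]
    rw [d1, (d2 s).deriv]
    linarith [hFβ s]

lemma semiconvex {F : ℝ → ℝ} {β : ℝ} (hF : ConvexOn ℝ univ (fun s => F s + β / 2 * s ^ 2))
    (a b : ℝ) {t : ℝ} (h0 : 0 ≤ t) (h1 : t ≤ 1) :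
    F (a + t * (b - a)) ≤ F a + t * (F b - F a) + β / 2 * (t * (1 - t)) * (b - a) ^ 2 := by
  have := hF.2 (mem_univ a) (mem_univ b) (sub_nonneg.2 h1) h0 (by ring)
  simp only [smul_eq_mul] at this
  rw [show (1 - t) * a + t * b = a + t * (b - a) by ring] at this
  nlinarith

lemma exists_quadratic_lower_bound {F : ℝ → ℝ} (hd : Differentiable ℝ F) {β : ℝ} (hβ : 0 ≤ β)
    (hF : ConvexOn ℝ univ (fun s => F s + β / 2 * s ^ 2)) (m : ℝ) :
    ∃ C : ℝ, 0 ≤ C ∧ ∀ s, 0 ≤ F (m + s) + C * (1 + s ^ 2) := by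
  set g : ℝ → ℝ := fun s => F s + β / 2 * s ^ 2 with hg
  have hgd : Differentiable ℝ g := hd.add (by fun_prop)
  set p := deriv g m
  have tangent : ∀ s, g m + p * s ≤ g (m + s) := by
    intro s
    rcases lt_trichotomy s 0 with h | h | h
    · have := hF.slope_le_of_hasDerivAt (mem_univ (m + s)) (mem_univ m) (by linarith)
        (hgd m).hasDerivAt
      rw [slope_def_field, div_le_iff₀ (by linarith)] at this
      have e : m - (m + s) = -s := by ring
      rw [e] at this
      change g m - g (m + s) ≤ p * -s at this
      linarith
    · simp [h]
    · have := hF.le_slope_of_hasDerivAt (mem_univ m) (mem_univ (m + s)) (by linarith)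
        (hgd m).hasDerivAt
      rw [slope_def_field, le_div_iff₀ (by linarith)] at this
      have e : m + s - m = s := by ring
      rw [e] at this
      change p * s ≤ g (m + s) - g m at this
      linarith
  refine ⟨|g m| + |p| + β * (1 + m ^ 2), by positivity, fun s => ?_⟩
  have h1 := tangent s
  have h2 : F (m + s) = g (m + s) - β / 2 * (m + s) ^ 2 := by simp [hg]
  have h3 : (m + s) ^ 2 ≤ 2 * (1 + m ^ 2) * (1 + s ^ 2) := by
    nlinarith [sq_nonneg (m - s), sq_nonneg (m * s)]
  have h3' := mul_le_mul_of_nonneg_left h3 (by positivity : 0 ≤ β / 2)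
  have h4 : -|p| * (1 + s ^ 2) ≤ p * s := by
    have : |p * s| ≤ |p| * (1 + s ^ 2) := by
      rw [abs_mul]
      refine mul_le_mul_of_nonneg_left ?_ (abs_nonneg _)
      rw [abs_le]; constructor <;> nlinarith [sq_nonneg (s - 1), sq_nonneg (s + 1)]
    linarith [neg_abs_le (p * s)]
  have h5 : -|g m| * (1 + s ^ 2) ≤ g m := by
    nlinarith [neg_abs_le (g m), abs_nonneg (g m), sq_nonneg s, mul_nonneg (abs_nonneg (g m)) (sq_nonneg s)]
  rw [h2]
  linarith

lemma abs_sub_sub_mul_le {A K : ℝ → ℝ} {L : ℝ≥0} (hA : LipschitzWith L A)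
    (hK : ∀ s : ℝ, HasDerivAt K (A s) s) (a b : ℝ) :
    |K b - K a - A a * (b - a)| ≤ L * (b - a) ^ 2 := by
  have h := Convex.norm_image_sub_le_of_norm_hasDerivWithin_le
    (f := fun s => K s - A a * s) (f' := fun s => A s - A a) (C := L * |b - a|)
    (s := uIcc a b) (x := a) (y := b)
    (fun s _ => by simpa using ((hK s).fun_sub ((hasDerivAt_id' s).const_mul (A a))).hasDerivWithinAt)
    (fun s hs => by
      have := hA.dist_le_mul s a
      rw [Real.dist_eq, Real.dist_eq] at this
      rw [Real.norm_eq_abs]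
      exact this.trans (mul_le_mul_of_nonneg_left (abs_sub_left_of_mem_uIcc hs) L.2))
    (convex_uIcc a b) left_mem_uIcc right_mem_uIcc
  rw [Real.norm_eq_abs, Real.norm_eq_abs, mul_assoc, ← sq, sq_abs] at h
  rwa [show K b - K a - A a * (b - a) = K b - A a * b - (K a - A a * a) by ring]

lemma lipschitzWith_of_hasDerivAt {A K : ℝ → ℝ} {Amin Amax : ℝ} (hAmin : 0 < Amin)
    (hA : ∀ s : ℝ, Amin ≤ A s ∧ A s ≤ Amax) (hK : ∀ s : ℝ, HasDerivAt K (A s) s) :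
    LipschitzWith Amax.toNNReal K := by
  refine lipschitzWith_of_nnnorm_deriv_le (fun s => (hK s).differentiableAt) fun s => ?_
  rw [(hK s).deriv, ← NNReal.coe_le_coe, coe_nnnorm, Real.norm_eq_abs,
    abs_of_pos (hAmin.trans_le (hA s).1)]
  exact (hA s).2.trans (Real.le_coe_toNNReal _)

/-- Along a segment, `½ (z - K u)²` lies below its chord up to a term of the order `h²`, with a
factor that only involves the value of `|z - K u|` at the starting point, and a term of second
order. -/
lemma half_sq_le_chord {A K : ℝ → ℝ} {L Λ : ℝ≥0} (hA : LipschitzWith L A)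
    (hK : ∀ s : ℝ, HasDerivAt K (A s) s) (hKL : LipschitzWith Λ K) {M a b z z' t : ℝ}
    (hM : |z - K a| ≤ M) (h0 : 0 ≤ t) :
    1 / 2 * (z + t * (z' - z) - K (a + t * (b - a))) ^ 2 ≤
      1 / 2 * (z - K a) ^ 2 + t * (1 / 2 * (z' - K b) ^ 2 - 1 / 2 * (z - K a) ^ 2
        + M * L * (b - a) ^ 2)
      + t ^ 2 * ((M * L + Λ ^ 2) * (b - a) ^ 2 + (z' - z) ^ 2) := by
  have hM0 : 0 ≤ M := (abs_nonneg _).trans hM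
  set p := z - K a with hp
  set h := b - a with hh
  set y := z' - z with hy
  have k1 := abs_sub_sub_mul_le hA hK a (a + t * h)
  have k2 := abs_sub_sub_mul_le hA hK a b
  have k3 := hKL.dist_le_mul (a + t * h) a
  rw [Real.dist_eq, Real.dist_eq, add_sub_cancel_left, abs_mul, abs_of_nonneg h0] at k3
  rw [add_sub_cancel_left] at k1
  set δ := K (a + t * h) - K a with hδ
  set δ' := K b - K a with hδ'
  have q1 : z + t * y - K (a + t * h) = p + (t * y - δ) := by rw [hp, hδ]; ring
  have q2 : z' - K b = p + (y - δ') := by rw [hp, hδ', hy]; ring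
  have r1 : |p * (δ - A a * (t * h))| ≤ M * (L * (t * h) ^ 2) := by
    rw [abs_mul]; exact mul_le_mul hM k1 (abs_nonneg _) hM0
  have r2 : |p * (δ' - A a * h)| ≤ M * (L * h ^ 2) := by
    rw [abs_mul]; exact mul_le_mul hM k2 (abs_nonneg _) hM0
  have r2' := mul_le_mul_of_nonneg_left (abs_le.1 r2).1 h0
  have r2'' := mul_le_mul_of_nonneg_left (abs_le.1 r2).2 h0
  have r3 : δ ^ 2 ≤ t ^ 2 * (Λ ^ 2 * h ^ 2) := by
    have := pow_le_pow_left₀ (abs_nonneg _) k3 2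
    rw [sq_abs] at this
    calc δ ^ 2 ≤ _ := this
      _ = _ := by rw [mul_pow, mul_pow, sq_abs]; ring
  have r4 : (t * y - δ) ^ 2 ≤ 2 * (t ^ 2 * y ^ 2 + δ ^ 2) := by
    nlinarith [sq_nonneg (t * y + δ)]
  have r5 : 0 ≤ t * (y - δ') ^ 2 := mul_nonneg h0 (sq_nonneg _)
  rw [q1, q2]
  nlinarith [(abs_le.1 r1).1, (abs_le.1 r1).2]

/-! ### Representation of functionals by functions in `H^1_av` -/

variable {d : ℕ} {Ω : Set (Space d)}

lemma IsAdmissibleDomain.isFiniteMeasure (hΩ : IsAdmissibleDomain Ω) :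
    IsFiniteMeasure ((volume : Measure (Space d)).restrict Ω) :=
  isFiniteMeasure_restrict.2 hΩ.isBounded.measure_lt_top.ne

lemma Hav1.norm_def (φ : Hav1 Ω) : ‖φ‖ = ‖Hav1.grad φ‖ := rfl

lemma Hav1.isWeakGrad (φ : Hav1 Ω) : IsWeakGrad Ω (Hav1.fn φ) (Hav1.grad φ) := φ.2.1

lemma Hav1.integrableOn (φ : Hav1 Ω) : IntegrableOn (Hav1.fn φ) Ω := φ.2.2.1

lemma Represents.add {w w' : Hav1Dual Ω} {f f' : LpOn Ω ℝ 2} (h : Represents w f)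
    (h' : Represents w' f') : Represents (w + w') (f + f') := by
  refine ⟨(h.1.add h'.1).congr (Lp.coeFn_add f f').symm, ?_, fun ψ => ?_⟩
  · rw [integral_congr_ae (Lp.coeFn_add f f')]
    simp only [Pi.add_apply]
    rw [integral_add h.1 h'.1, h.2.1, h'.2.1, add_zero]
  · rw [inner_add_left, ← h.2.2, ← h'.2.2]; rfl

lemma Represents.smul {w : Hav1Dual Ω} {f : LpOn Ω ℝ 2} (h : Represents w f) (c : ℝ) :
    Represents (c • w) (c • f) := by
  refine ⟨(h.1.smul c).congr (Lp.coeFn_smul c f).symm, ?_, fun ψ => ?_⟩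
  · rw [integral_congr_ae (Lp.coeFn_smul c f)]
    simp only [Pi.smul_apply]
    rw [integral_smul, h.2.1, smul_zero]
  · rw [real_inner_smul_left, ← h.2.2]; rfl

lemma Represents.sub {w w' : Hav1Dual Ω} {f f' : LpOn Ω ℝ 2} (h : Represents w f)
    (h' : Represents w' f') : Represents (w - w') (f - f') := by
  have := h.add (h'.smul (-1))
  simpa [sub_eq_add_neg] using this

/-- Interpolation of `L²` between `H^1_av` and its dual. -/
lemma Represents.norm_sq_le {w : Hav1Dual Ω} {φ : Hav1 Ω} (h : Represents w (Hav1.fn φ)) :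
    ‖Hav1.fn φ‖ ^ 2 ≤ ‖w‖ * ‖φ‖ := by
  rw [← real_inner_self_eq_norm_sq, ← h.2.2 φ]
  exact (le_abs_self _).trans (w.le_opNorm φ)

lemma Represents.fn_eq {w : Hav1Dual Ω} {φ ψ : Hav1 Ω} (h : Represents w (Hav1.fn φ))
    (h' : Represents w (Hav1.fn ψ)) : Hav1.fn φ = Hav1.fn ψ := by
  have h0 : Represents (w - w) (Hav1.fn (φ - ψ)) := by rw [map_sub]; exact h.sub h'
  have h1 : ‖Hav1.fn (φ - ψ)‖ ^ 2 = 0 := by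
    rw [← real_inner_self_eq_norm_sq, ← h0.2.2 (φ - ψ), sub_self]; rfl
  have h2 : Hav1.fn (φ - ψ) = 0 := norm_eq_zero.1 (pow_eq_zero_iff (by norm_num) |>.1 h1)
  rwa [map_sub, sub_eq_zero] at h2

/-- A function in `H^1_av` is determined by its values, as weak gradients in an open set are
unique. -/
lemma Hav1.ext_fn (hΩ : IsOpen Ω) {φ ψ : Hav1 Ω} (h : Hav1.fn φ = Hav1.fn ψ) : φ = ψ := by
  suffices hg : Hav1.grad (φ - ψ) = 0 by
    rw [map_sub, sub_eq_zero] at hg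
    exact Subtype.ext (Prod.ext h hg)
  have hf : Hav1.fn (φ - ψ) = 0 := by rw [map_sub, h, sub_self]
  set χ := φ - ψ
  have hw := χ.isWeakGrad
  have hz : ∀ e : Space d, ∀ᵐ x ∂volume, x ∈ Ω → ⟪Hav1.grad χ x, e⟫_ℝ = 0 := by
    intro e
    have hmem : MemLp (fun x => ⟪Hav1.grad χ x, e⟫_ℝ) 2 (volume.restrict Ω) :=
      memLp_clm_apply ((innerSL ℝ (E := Space d)).comp_memLp' (Lp.memLp (Hav1.grad χ))) e
    refine hΩ.ae_eq_zero_of_integral_contDiff_smul_eq_zero ?_ fun η h1 h2 h3 => ?_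
    · refine (locallyIntegrableOn_iff hΩ.isLocallyClosed).2 fun k hk hkc => ?_
      have : IsFiniteMeasure ((volume : Measure (Space d)).restrict k) :=
        isFiniteMeasure_restrict.2 hkc.measure_lt_top.ne
      have h2 : MemLp (fun x => ⟪Hav1.grad χ x, e⟫_ℝ) 2 (volume.restrict k) :=
        hmem.mono_measure (Measure.restrict_mono hk le_rfl)
      exact h2.integrable (by norm_num)
    · have := hw η h1 h2 h3 e
      have hl : ∫ x in Ω, (fderiv ℝ η x e) • (Hav1.fn χ) x = 0 := by
        rw [hf]
        rw [integral_congr_ae (g := fun _ => 0)]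
        · simp
        · filter_upwards [Lp.coeFn_zero ℝ 2 ((volume : Measure (Space d)).restrict Ω)] with x hx
          rw [hx]; simp
      rw [hl] at this
      have h4 : ∫ x in Ω, η x • ⟪Hav1.grad χ x, e⟫_ℝ = 0 := by
        have := neg_eq_zero.1 this.symm
        simpa using this
      rw [← h4, setIntegral_eq_integral_of_forall_compl_eq_zero]
      intro x hx
      rw [image_eq_zero_of_notMem_tsupport fun hx' => hx (h3 hx'), zero_smul]
  refine (Lp.eq_zero_iff_ae_eq_zero).2 ?_
  have hall : ∀ᵐ x ∂(volume : Measure (Space d)), ∀ i : Fin d, x ∈ Ω →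
      ⟪Hav1.grad χ x, EuclideanSpace.single i (1 : ℝ)⟫_ℝ = 0 :=
    ae_all_iff.2 fun i => hz _
  filter_upwards [(ae_restrict_iff' hΩ.measurableSet).2
    (hall.mono fun x hx hxΩ i => hx i hxΩ)] with x hx
  ext i
  have h := hx i
  rw [EuclideanSpace.inner_single_right] at h
  simpa using h

/-! ### The energy of a represented state -/

/-- The real-valued energy `∫_Ω (½|∇φ|² + F(m + φ) + ½(z - K(m + φ))²) dx` of `(m + φ, z)`,
meaningful if `F (m + φ)` is integrable. -/
noncomputable def energyReal (F K : ℝ → ℝ) (m : ℝ) (φ : Hav1 Ω) (z : LpOn Ω ℝ 2) : ℝ :=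
  ∫ x in Ω, ((1 / 2 * ‖Hav1.grad φ x‖ ^ 2 + F (m + Hav1.fn φ x))
    + 1 / 2 * (z x - K (m + Hav1.fn φ x)) ^ 2)

lemma energy_eq (hΩ : IsOpen Ω) (F K : ℝ → ℝ) (m : ℝ) {v : H Ω} {φ : Hav1 Ω}
    (h : Represents v.fst (Hav1.fn φ)) :
    energy Ω F K m v =
      energyIntegral Ω F K (fun x => m + Hav1.fn φ x) (Hav1.grad φ) v.snd := by
  unfold energy
  refine le_antisymm (iInf₂_le φ h) (le_iInf₂ fun ψ hψ => ?_)
  rw [Hav1.ext_fn hΩ (hψ.fn_eq h)]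

lemma energy_eq_coe (hΩ : IsOpen Ω) (F K : ℝ → ℝ) (m : ℝ) {v : H Ω} {φ : Hav1 Ω}
    (h : Represents v.fst (Hav1.fn φ)) (hi : IntegrableOn (fun x => F (m + Hav1.fn φ x)) Ω) :
    energy Ω F K m v = (energyReal F K m φ v.snd : EReal) := by
  rw [energy_eq hΩ F K m h, energyIntegral, if_pos hi]; rfl

lemma exists_of_energy_ne_top {F K : ℝ → ℝ} {m : ℝ} {v : H Ω} (h : energy Ω F K m v ≠ ⊤) :
    ∃ φ : Hav1 Ω, Represents v.fst (Hav1.fn φ) ∧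
      IntegrableOn (fun x => F (m + Hav1.fn φ x)) Ω := by
  by_contra hcon
  push Not at hcon
  refine h ?_
  unfold energy
  rw [iInf_eq_top]
  intro φ
  rw [iInf_eq_top]
  intro hφ
  rw [energyIntegral, if_neg (hcon φ hφ)]

lemma memLp_sub_comp [IsFiniteMeasure ((volume : Measure (Space d)).restrict Ω)] {K : ℝ → ℝ}
    {Λ : ℝ≥0} (hKL : LipschitzWith Λ K) (m : ℝ) (f z : LpOn Ω ℝ 2) :
    MemLp (fun x => z x - K (m + f x)) 2 (volume.restrict Ω) := by
  refine (Lp.memLp z).sub ?_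
  have h0 : MemLp (fun x => (Λ : ℝ) * ‖f x‖) 2 (volume.restrict Ω) :=
    (Lp.memLp f).norm.const_mul _
  have h1 : MemLp (fun x => |K m| + Λ * ‖f x‖) 2 (volume.restrict Ω) :=
    (memLp_const |K m|).add h0
  refine h1.mono ?_ (Eventually.of_forall fun x => ?_)
  · have hm : AEStronglyMeasurable (fun x => m + f x) (volume.restrict Ω) :=
      aestronglyMeasurable_const.add (Lp.aestronglyMeasurable f)
    exact hKL.continuous.comp_aestronglyMeasurable hm
  · have := hKL.dist_le_mul (m + f x) m
    simp only [Real.dist_eq, add_sub_cancel_left] at this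
    have h2 : |K (m + f x)| ≤ |K m| + |K (m + f x) - K m| := by
      have := abs_add_le (K m) (K (m + f x) - K m); simpa using this
    rw [Real.norm_eq_abs, Real.norm_eq_abs, Real.norm_eq_abs,
      abs_of_nonneg (a := _ + _) (by positivity)]
    linarith

lemma integrable_norm_sq {V : Type} [NormedAddCommGroup V] (f : LpOn Ω V 2) :
    Integrable (fun x => ‖f x‖ ^ 2) (volume.restrict Ω) :=
  (Lp.memLp f).integrable_norm_pow (p := 2) (by norm_num)

lemma integral_norm_sq {V : Type} [NormedAddCommGroup V] [InnerProductSpace ℝ V]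
    (f : LpOn Ω V 2) : ∫ x in Ω, ‖f x‖ ^ 2 = ‖f‖ ^ 2 := by
  rw [← real_inner_self_eq_norm_sq, L2.inner_def]
  simp_rw [real_inner_self_eq_norm_sq]

lemma integrable_density [IsFiniteMeasure ((volume : Measure (Space d)).restrict Ω)]
    {F K : ℝ → ℝ} {Λ : ℝ≥0} (hKL : LipschitzWith Λ K) {m : ℝ} {φ : Hav1 Ω} (z : LpOn Ω ℝ 2)
    (hi : IntegrableOn (fun x => F (m + Hav1.fn φ x)) Ω) :
    Integrable (fun x => (1 / 2 * ‖Hav1.grad φ x‖ ^ 2 + F (m + Hav1.fn φ x))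
      + 1 / 2 * (z x - K (m + Hav1.fn φ x)) ^ 2) (volume.restrict Ω) :=
  (((integrable_norm_sq _).const_mul _).add hi).add
    ((memLp_sub_comp hKL m _ z).integrable_sq.const_mul _)

lemma coeFn_segment {V : Type} [NormedAddCommGroup V] [NormedSpace ℝ V] (f g : LpOn Ω V 2)
    (t : ℝ) : ∀ᵐ x ∂(volume.restrict Ω), (f + t • (g - f)) x = f x + t • (g x - f x) := by
  filter_upwards [Lp.coeFn_add f (t • (g - f)), Lp.coeFn_smul t (g - f), Lp.coeFn_sub g f]
    with x h1 h2 h3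
  rw [h1, Pi.add_apply, h2, Pi.smul_apply, h3, Pi.sub_apply]

lemma integrable_comp_segment [IsFiniteMeasure ((volume : Measure (Space d)).restrict Ω)]
    {F : ℝ → ℝ} (hFd : Differentiable ℝ F) {β : ℝ} (hβ : 0 ≤ β)
    (hF : ConvexOn ℝ univ (fun s => F s + β / 2 * s ^ 2)) (m : ℝ) {f g : LpOn Ω ℝ 2}
    (hf : IntegrableOn (fun x => F (m + f x)) Ω) (hg : IntegrableOn (fun x => F (m + g x)) Ω)
    {t : ℝ} (h0 : 0 ≤ t) (h1 : t ≤ 1) :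
    IntegrableOn (fun x => F (m + (f + t • (g - f)) x)) Ω := by
  obtain ⟨C, hC, hlow⟩ := exists_quadratic_lower_bound hFd hβ hF m
  have hd := integrable_norm_sq (g - f)
  have hs := integrable_norm_sq (f + t • (g - f))
  have hup : Integrable (fun x => F (m + f x) + t * (F (m + g x) - F (m + f x))
      + β / 2 * (t * (1 - t)) * ‖(g - f) x‖ ^ 2) (volume.restrict Ω) :=
    (hf.add ((hg.sub hf).const_mul _)).add (hd.const_mul _)
  have hlo : Integrable (fun x => C * (1 + ‖(f + t • (g - f)) x‖ ^ 2)) (volume.restrict Ω) :=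
    ((integrable_const _).add hs).const_mul _
  refine (hup.abs.add hlo).mono' ?_ ?_
  · exact hFd.continuous.comp_aestronglyMeasurable
      (aestronglyMeasurable_const.add (Lp.aestronglyMeasurable _))
  · filter_upwards [coeFn_segment f g t, Lp.coeFn_sub g f] with x hx hx'
    have e1 := semiconvex hF (m + f x) (m + g x) h0 h1
    have e2 := hlow ((f + t • (g - f)) x)
    simp only [Pi.add_apply, Real.norm_eq_abs, sq_abs]
    set up := F (m + f x) + t * (F (m + g x) - F (m + f x))
      + β / 2 * (t * (1 - t)) * (g - f) x ^ 2 with hup'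
    have e3 : F (m + (f + t • (g - f)) x) ≤ up := by
      rw [hx, hup', hx']
      simp only [smul_eq_mul, Pi.sub_apply]
      rw [show m + (f x + t * (g x - f x)) = m + f x + t * (m + g x - (m + f x)) by ring]
      rw [show m + g x - (m + f x) = g x - f x by ring] at e1
      rw [show m + g x - (m + f x) = g x - f x by ring]
      exact e1
    rw [abs_le]
    constructor
    · linarith [abs_nonneg up]
    · have : 0 ≤ C * (1 + (f + t • (g - f)) x ^ 2) := by positivity
      linarith [le_abs_self up]

lemma integral_quadratic_combination {α : Type*} [MeasurableSpace α] {ν : Measure α}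
    {f g k h y : α → ℝ} (hf : Integrable f ν) (hg : Integrable g ν) (hk : Integrable k ν)
    (hh : Integrable h ν) (hy : Integrable y ν) {t b c c' : ℝ} :
    ∫ x, (f x + t * (g x - f x - b * k x + c * h x) + t ^ 2 * (b * k x + c' * h x + y x)) ∂ν =
      ∫ x, f x ∂ν + t * (∫ x, g x ∂ν - ∫ x, f x ∂ν - b * ∫ x, k x ∂ν + c * ∫ x, h x ∂ν)
        + t ^ 2 * (b * ∫ x, k x ∂ν + c' * ∫ x, h x ∂ν + ∫ x, y x ∂ν) := by
  have a1 : Integrable (fun x => g x - f x) ν := hg.sub hf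
  have a2 : Integrable (fun x => g x - f x - b * k x) ν := a1.sub (hk.const_mul b)
  have a3 : Integrable (fun x => g x - f x - b * k x + c * h x) ν := a2.add (hh.const_mul c)
  have a4 : Integrable (fun x => f x + t * (g x - f x - b * k x + c * h x)) ν :=
    hf.add (a3.const_mul t)
  have b1 : Integrable (fun x => b * k x + c' * h x) ν := (hk.const_mul b).add (hh.const_mul c')
  have b2 : Integrable (fun x => b * k x + c' * h x + y x) ν := b1.add hy
  rw [integral_add a4 (b2.const_mul _), integral_add hf (a3.const_mul _), integral_const_mul,
    integral_const_mul, integral_add a2 (hh.const_mul c), integral_sub a1 (hk.const_mul b),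
    integral_sub hg hf, integral_add b1 hy, integral_add (hk.const_mul b) (hh.const_mul c')]
  simp only [integral_const_mul]

/-- Semiconvexity of the energy along segments, with explicit dependence on the bound `M` for
`z - K(u)` at the initial point. -/
lemma energyReal_segment_le [IsFiniteMeasure ((volume : Measure (Space d)).restrict Ω)]
    {F : ℝ → ℝ} (hFd : Differentiable ℝ F) {β : ℝ} (hβ : 0 ≤ β)
    (hF : ConvexOn ℝ univ (fun s => F s + β / 2 * s ^ 2))
    {A K : ℝ → ℝ} {L Λ : ℝ≥0} (hA : LipschitzWith L A)
    (hK : ∀ s : ℝ, HasDerivAt K (A s) s) (hKL : LipschitzWith Λ K) (m : ℝ)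
    {φ φ' : Hav1 Ω} {z z' : LpOn Ω ℝ 2}
    (hi : IntegrableOn (fun x => F (m + Hav1.fn φ x)) Ω)
    (hi' : IntegrableOn (fun x => F (m + Hav1.fn φ' x)) Ω) {M : ℝ}
    (hM : ∀ᵐ x ∂(volume.restrict Ω), |z x - K (m + Hav1.fn φ x)| ≤ M)
    {t : ℝ} (h0 : 0 ≤ t) (h1 : t ≤ 1) :
    energyReal F K m (φ + t • (φ' - φ)) (z + t • (z' - z)) ≤
      energyReal F K m φ z
      + t * (energyReal F K m φ' z' - energyReal F K m φ z - 1 / 2 * ‖φ' - φ‖ ^ 2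
        + (β / 2 + M * L) * ‖Hav1.fn (φ' - φ)‖ ^ 2)
      + t ^ 2 * (1 / 2 * ‖φ' - φ‖ ^ 2 + (M * L + Λ ^ 2) * ‖Hav1.fn (φ' - φ)‖ ^ 2
        + ‖z' - z‖ ^ 2) := by
  have i0 := integrable_density hKL z hi
  have i1 := integrable_density hKL z' hi'
  have ik := integrable_norm_sq (Hav1.grad (φ' - φ))
  have ih := integrable_norm_sq (Hav1.fn (φ' - φ))
  have iy := integrable_norm_sq (z' - z)
  have it : IntegrableOn (fun x => F (m + Hav1.fn (φ + t • (φ' - φ)) x)) Ω := by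
    rw [map_add, map_smul, map_sub]
    exact integrable_comp_segment hFd hβ hF m hi hi' h0 h1
  have it' := integrable_density hKL (z + t • (z' - z)) it
  rw [Hav1.norm_def, ← integral_norm_sq, ← integral_norm_sq (Hav1.fn (φ' - φ)),
    ← integral_norm_sq (z' - z)]
  unfold energyReal
  rw [← integral_quadratic_combination i0 i1 ik ih iy]
  refine integral_mono_ae it' ((i0.add ((((i1.sub i0).sub (ik.const_mul _)).add
    (ih.const_mul _)).const_mul _)).add ((((ik.const_mul _).add (ih.const_mul _)).add
    iy).const_mul _)) ?_
  filter_upwards [hM, coeFn_segment (Hav1.fn φ) (Hav1.fn φ') t,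
    coeFn_segment (Hav1.grad φ) (Hav1.grad φ') t, coeFn_segment z z' t,
    Lp.coeFn_sub (Hav1.fn φ') (Hav1.fn φ), Lp.coeFn_sub (Hav1.grad φ') (Hav1.grad φ),
    Lp.coeFn_sub z' z] with x hMx c1 c2 c3 c4 c5 c6
  have hc1 : Hav1.fn (φ + t • (φ' - φ)) x = Hav1.fn φ x + t * (Hav1.fn φ' x - Hav1.fn φ x) := by
    rw [map_add, map_smul, map_sub, c1, smul_eq_mul]
  have hc2 : Hav1.grad (φ + t • (φ' - φ)) x
      = Hav1.grad φ x + t • (Hav1.grad φ' x - Hav1.grad φ x) := by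
    rw [map_add, map_smul, map_sub, c2]
  have hc4 : Hav1.fn (φ' - φ) x = Hav1.fn φ' x - Hav1.fn φ x := by rw [map_sub, c4]; rfl
  have hc5 : Hav1.grad (φ' - φ) x = Hav1.grad φ' x - Hav1.grad φ x := by rw [map_sub, c5]; rfl
  simp only [Pi.sub_apply, hc1, hc2, hc4, hc5, c3, c6, smul_eq_mul,
    Real.norm_eq_abs, sq_abs]
  generalize Hav1.fn φ x = a at *
  generalize Hav1.fn φ' x = b at *
  generalize Hav1.grad φ x = g at *
  generalize Hav1.grad φ' x = g' at *
  generalize z x = ζ at *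
  generalize z' x = ζ' at *
  have e1 := semiconvex hF (m + a) (m + b) h0 h1
  have e2 := half_sq_le_chord (z' := ζ') (b := m + b) hA hK hKL hMx h0
  rw [show m + b - (m + a) = b - a by ring] at e1 e2
  rw [show m + a + t * (b - a) = m + (a + t * (b - a)) by ring] at e1 e2
  have e3 : ‖g + t • (g' - g)‖ ^ 2 = ‖g‖ ^ 2 + t * (‖g'‖ ^ 2 - ‖g‖ ^ 2)
      - t * (1 - t) * ‖g' - g‖ ^ 2 := by
    have q1 : ‖g'‖ ^ 2 = ‖g + (g' - g)‖ ^ 2 := by rw [add_sub_cancel]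
    rw [q1, norm_add_sq_real, norm_add_sq_real, norm_smul, inner_smul_right, mul_pow,
      Real.norm_eq_abs, sq_abs]
    ring
  have e4 : 0 ≤ β / 2 * t ^ 2 * (b - a) ^ 2 := by positivity
  rw [e3]
  linarith

/-- An element of the Gateaux subdifferential satisfies a global one-sided estimate, which even
controls the distance in `H^1`. -/
lemma pairing_le_of_mem_gateauxSubdiff
    [IsFiniteMeasure ((volume : Measure (Space d)).restrict Ω)] (hΩ : IsOpen Ω)
    {F : ℝ → ℝ} (hFd : Differentiable ℝ F) {β : ℝ} (hβ : 0 ≤ β)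
    (hF : ConvexOn ℝ univ (fun s => F s + β / 2 * s ^ 2))
    {A K : ℝ → ℝ} {L Λ : ℝ≥0} (hA : LipschitzWith L A)
    (hK : ∀ s : ℝ, HasDerivAt K (A s) s) (hKL : LipschitzWith Λ K) (m : ℝ)
    {v v' : H Ω} {φ φ' : Hav1 Ω} (hφ : Represents v.fst (Hav1.fn φ))
    (hφ' : Represents v'.fst (Hav1.fn φ'))
    (hi : IntegrableOn (fun x => F (m + Hav1.fn φ x)) Ω)
    (hi' : IntegrableOn (fun x => F (m + Hav1.fn φ' x)) Ω) {M : ℝ} (hM0 : 0 ≤ M)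
    (hM : ∀ᵐ x ∂(volume.restrict Ω), |v.snd x - K (m + Hav1.fn φ x)| ≤ M)
    {μ : HStar Ω} (hμ : μ ∈ gateauxSubdiff (energy Ω F K m) v) :
    pairing μ (v' - v) ≤ energyReal F K m φ' v'.snd - energyReal F K m φ v.snd
      - 1 / 4 * ‖φ' - φ‖ ^ 2 + (β / 2 + M * L) ^ 2 * ‖(v' - v).fst‖ ^ 2 := by
  set Γ := β / 2 + M * L with hΓ
  have hΓ0 : 0 ≤ Γ := by positivity
  set Δ := energyReal F K m φ' v'.snd - energyReal F K m φ v.snd - 1 / 2 * ‖φ' - φ‖ ^ 2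
        + Γ * ‖Hav1.fn (φ' - φ)‖ ^ 2 with hΔ
  have hrep : Represents (v' - v).fst (Hav1.fn (φ' - φ)) := by
    rw [map_sub]; exact hφ'.sub hφ
  suffices h : pairing μ (v' - v) ≤ Δ by
    have h1 := mul_le_mul_of_nonneg_left hrep.norm_sq_le hΓ0
    nlinarith [sq_nonneg (1 / 2 * ‖φ' - φ‖ - Γ * ‖(v' - v).fst‖)]
  set R := 1 / 2 * ‖φ' - φ‖ ^ 2 + (M * L + Λ ^ 2) * ‖Hav1.fn (φ' - φ)‖ ^ 2
        + ‖v'.snd - v.snd‖ ^ 2 with hR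
  have hlim : Tendsto (fun t : ℝ => ((Δ + t * R : ℝ) : EReal)) (𝓝[>] 0) (𝓝 (Δ : EReal)) := by
    refine (continuous_coe_real_ereal.tendsto _).comp ?_
    have : Tendsto (fun t : ℝ => Δ + t * R) (𝓝 0) (𝓝 (Δ + 0 * R)) :=
      (Continuous.tendsto (by fun_prop) _)
    simp only [zero_mul, add_zero] at this
    exact this.mono_left nhdsWithin_le_nhds
  have hle : liminf (fun t : ℝ => (energy Ω F K m (v + t • (v' - v)) - energy Ω F K m v)
      / (t : EReal)) (𝓝[>] 0) ≤ (Δ : EReal) := by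
    rw [← hlim.liminf_eq]
    refine liminf_le_liminf ?_
    filter_upwards [Ioo_mem_nhdsGT (show (0 : ℝ) < 1 by norm_num)] with t ht
    have hseg : Represents (v + t • (v' - v)).fst (Hav1.fn (φ + t • (φ' - φ))) := by
      rw [map_add, map_smul]; exact hφ.add (hrep.smul t)
    have it : IntegrableOn (fun x => F (m + Hav1.fn (φ + t • (φ' - φ)) x)) Ω := by
      rw [map_add, map_smul, map_sub]
      exact integrable_comp_segment hFd hβ hF m hi hi' ht.1.le ht.2.le
    rw [energy_eq_coe hΩ F K m hseg it, energy_eq_coe hΩ F K m hφ hi, ← EReal.coe_sub,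
      ← EReal.coe_div, EReal.coe_le_coe_iff, div_le_iff₀ ht.1]
    have := energyReal_segment_le hFd hβ hF hA hK hKL m (z' := v'.snd) hi hi' hM ht.1.le ht.2.le
    have e : (v + t • (v' - v)).snd = v.snd + t • (v'.snd - v.snd) := rfl
    rw [e, sub_le_iff_le_add]
    refine this.trans (le_of_eq ?_)
    rw [hΔ, hR, hΓ]
    ring
  exact EReal.coe_le_coe_iff.1 ((hμ.2 (v' - v)).trans hle)

/-! ### Lower semicontinuity of the energy -/

lemma exists_subseq_tendsto_ae {α V : Type*} [MeasurableSpace α] {ν : Measure α}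
    [NormedAddCommGroup V] {f : ℕ → Lp V 2 ν} {g : Lp V 2 ν} (h : Tendsto f atTop (𝓝 g)) :
    ∃ n : ℕ → ℕ, StrictMono n ∧ ∀ᵐ x ∂ν, Tendsto (fun i => f (n i) x) atTop (𝓝 (g x)) :=
  (tendstoInMeasure_of_tendsto_Lp h).exists_seq_tendsto_ae

/-- Fatou's lemma for real-valued functions. -/
lemma integrable_and_integral_le_of_tendsto {α : Type*} [MeasurableSpace α] {ν : Measure α}
    {p : ℕ → α → ℝ} {q : α → ℝ} {y : ℝ} (hp : ∀ n, Integrable (p n) ν)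
    (hp0 : ∀ n, 0 ≤ᵐ[ν] p n)
    (hpq : ∀ᵐ x ∂ν, Tendsto (fun n => p n x) atTop (𝓝 (q x)))
    (hy : Tendsto (fun n => ∫ x, p n x ∂ν) atTop (𝓝 y)) :
    Integrable q ν ∧ ∫ x, q x ∂ν ≤ y := by
  have hqm : AEStronglyMeasurable q ν :=
    aestronglyMeasurable_of_tendsto_ae atTop (fun n => (hp n).1) hpq
  have hq0 : 0 ≤ᵐ[ν] q := by
    filter_upwards [hpq, ae_all_iff.2 hp0] with x hx hx0
    exact ge_of_tendsto' hx hx0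
  have hy0 : 0 ≤ y := ge_of_tendsto' hy fun n => integral_nonneg_of_ae (hp0 n)
  have hle : ∫⁻ x, ENNReal.ofReal (q x) ∂ν ≤ ENNReal.ofReal y := by
    calc ∫⁻ x, ENNReal.ofReal (q x) ∂ν
        = ∫⁻ x, liminf (fun n => ENNReal.ofReal (p n x)) atTop ∂ν :=
          lintegral_congr_ae (by
            filter_upwards [hpq] with x hx
            exact (ENNReal.tendsto_ofReal hx).liminf_eq.symm)
      _ ≤ liminf (fun n => ∫⁻ x, ENNReal.ofReal (p n x) ∂ν) atTop :=
          lintegral_liminf_le' fun n => (hp n).1.aemeasurable.ennreal_ofReal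
      _ = ENNReal.ofReal y := by
          simp_rw [← fun n => ofReal_integral_eq_lintegral_ofReal (hp n) (hp0 n)]
          exact (ENNReal.tendsto_ofReal hy).liminf_eq
  have hqi : Integrable q ν :=
    (lintegral_ofReal_ne_top_iff_integrable hqm hq0).1 (hle.trans_lt ENNReal.ofReal_lt_top).ne
  refine ⟨hqi, ?_⟩
  rw [← ofReal_integral_eq_lintegral_ofReal hqi hq0] at hle
  exact (ENNReal.ofReal_le_ofReal_iff hy0).1 hle

lemma tendsto_integral_inner {α V : Type*} [MeasurableSpace α] {ν : Measure α}
    [NormedAddCommGroup V] [InnerProductSpace ℝ V] {f : ℕ → Lp V 2 ν} {g : Lp V 2 ν}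
    (h : Tendsto f atTop (𝓝 g)) {a : α → V} (ha : MemLp a 2 ν) :
    Tendsto (fun n => ∫ x, ⟪a x, f n x⟫_ℝ ∂ν) atTop (𝓝 (∫ x, ⟪a x, g x⟫_ℝ ∂ν)) := by
  have key : ∀ u : Lp V 2 ν, ∫ x, ⟪a x, u x⟫_ℝ ∂ν = ⟪ha.toLp a, u⟫_ℝ := fun u => by
    rw [L2.inner_def]
    refine integral_congr_ae ?_
    filter_upwards [ha.coeFn_toLp] with x hx
    rw [hx]
  simp_rw [key]
  exact (tendsto_const_nhds (x := ha.toLp a)).inner h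

/-- `H^1_av(Ω)` is closed in `L² × L²`. -/
lemma mem_Hav1Submodule_of_tendsto [IsFiniteMeasure ((volume : Measure (Space d)).restrict Ω)]
    {φ : ℕ → Hav1 Ω} {f : LpOn Ω ℝ 2} {g : LpOn Ω (Space d) 2}
    (hf : Tendsto (fun n => Hav1.fn (φ n)) atTop (𝓝 f))
    (hg : Tendsto (fun n => Hav1.grad (φ n)) atTop (𝓝 g)) :
    (f, g) ∈ Hav1Submodule Ω := by
  refine ⟨fun η h1 h2 h3 e => ?_, (Lp.memLp f).integrable (by norm_num), ?_⟩
  · have hc := continuous_dirDeriv h1 e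
    have ha : MemLp (fun x => fderiv ℝ η x e) 2 (volume.restrict Ω) :=
      (hc.memLp_of_hasCompactSupport (compactSupport_dirDeriv h2 e)
        (μ := (volume : Measure (Space d))) (p := 2)).restrict Ω
    have hb : MemLp (fun x => η x • e) 2 (volume.restrict Ω) :=
      ((h1.continuous.smul continuous_const).memLp_of_hasCompactSupport h2.smul_right
        (μ := (volume : Measure (Space d))) (p := 2)).restrict Ω
    have l1 := tendsto_integral_inner hf ha
    have l2 := (tendsto_integral_inner hg hb).neg
    have e1 : ∀ u : LpOn Ω ℝ 2, ∫ x in Ω, ⟪fderiv ℝ η x e, u x⟫_ℝ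
        = ∫ x in Ω, (fderiv ℝ η x e) • u x := fun u => by simp [mul_comm]
    have e2 : ∀ u : LpOn Ω (Space d) 2, ∫ x in Ω, ⟪η x • e, u x⟫_ℝ
        = ∫ x in Ω, η x • innerSL ℝ (u x) e := fun u => by
      simp [real_inner_smul_left, real_inner_comm]
    simp only [e1] at l1
    simp only [e2] at l2
    exact tendsto_nhds_unique l1 (l2.congr fun n => ((φ n).isWeakGrad η h1 h2 h3 e).symm)
  · have l1 := tendsto_integral_inner hf (memLp_const (1 : ℝ))
    have e1 : ∀ u : LpOn Ω ℝ 2, ∫ x in Ω, ⟪(1 : ℝ), u x⟫_ℝ = ∫ x in Ω, u x := fun u => by simp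
    simp only [e1] at l1
    exact tendsto_nhds_unique l1 (tendsto_const_nhds.congr fun n => (φ n).2.2.2.symm)

/-- Sequential lower semicontinuity of the energy, for states whose first components form a Cauchy
sequence in `H^1_av`. The nonnegative integrands obtained by adding a multiple of `1 + φ²` to the
energy density satisfy Fatou's lemma. -/
lemma energyReal_le_of_tendsto [IsFiniteMeasure ((volume : Measure (Space d)).restrict Ω)]
    {F : ℝ → ℝ} (hFd : Differentiable ℝ F) {β : ℝ} (hβ : 0 ≤ β)
    (hF : ConvexOn ℝ univ (fun s => F s + β / 2 * s ^ 2))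
    {K : ℝ → ℝ} {Λ : ℝ≥0} (hKL : LipschitzWith Λ K) (m : ℝ)
    {v : ℕ → H Ω} {u : H Ω} (hv : Tendsto v atTop (𝓝 u)) {φ : ℕ → Hav1 Ω}
    (hφ : ∀ n, Represents (v n).fst (Hav1.fn (φ n)))
    (hi : ∀ n, IntegrableOn (fun x => F (m + Hav1.fn (φ n) x)) Ω)
    (hc : ∀ ε > 0, ∃ N, ∀ j ≥ N, ∀ i ≥ j, ‖φ i - φ j‖ ≤ ε) {y : ℝ}
    (hy : Tendsto (fun n => energyReal F K m (φ n) (v n).snd) atTop (𝓝 y)) :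
    ∃ ψ : Hav1 Ω, Represents u.fst (Hav1.fn ψ) ∧
      IntegrableOn (fun x => F (m + Hav1.fn ψ x)) Ω ∧ energyReal F K m ψ u.snd ≤ y := by
  have hv1 : Tendsto (fun n => (v n).fst) atTop (𝓝 u.fst) :=
    ((WithLp.prod_continuous_ofLp 2 _ _).fst.tendsto u).comp hv
  have hv2 : Tendsto (fun n => (v n).snd) atTop (𝓝 u.snd) :=
    ((WithLp.prod_continuous_ofLp 2 _ _).snd.tendsto u).comp hv
  -- The gradients converge by assumption, the functions by interpolation.
  have cg : CauchySeq fun n => Hav1.grad (φ n) := by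
    refine Metric.cauchySeq_iff'.2 fun ε hε => ?_
    obtain ⟨N, hN⟩ := hc (ε / 2) (half_pos hε)
    refine ⟨N, fun n hn => ?_⟩
    rw [dist_eq_norm, ← map_sub, ← Hav1.norm_def]
    exact (hN N le_rfl n hn).trans_lt (half_lt_self hε)
  have cf : CauchySeq fun n => Hav1.fn (φ n) := by
    refine Metric.cauchySeq_iff'.2 fun ε hε => ?_
    obtain ⟨N, hN⟩ := hc (ε ^ 2 / 2) (by positivity)
    obtain ⟨N', hN'⟩ := Metric.cauchySeq_iff.1 hv1.cauchySeq 1 one_pos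
    refine ⟨max N N', fun n hn => ?_⟩
    have h1 := hN (max N N') (le_max_left _ _) n hn
    have h2 := hN' n ((le_max_right _ _).trans hn) (max N N') (le_max_right _ _)
    rw [dist_eq_norm] at h2 ⊢
    have h3 : Represents ((v n).fst - (v (max N N')).fst) (Hav1.fn (φ n - φ (max N N'))) := by
      rw [map_sub]; exact (hφ _).sub (hφ _)
    rw [← map_sub]
    refine lt_of_pow_lt_pow_left₀ 2 hε.le ?_
    have h4 := mul_le_mul h2.le h1 (norm_nonneg _) zero_le_one
    linarith [h3.norm_sq_le, sq_pos_of_pos hε]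
  obtain ⟨g, hg⟩ := cauchySeq_tendsto_of_complete cg
  obtain ⟨f, hf⟩ := cauchySeq_tendsto_of_complete cf
  set ψ : Hav1 Ω := ⟨(f, g), mem_Hav1Submodule_of_tendsto hf hg⟩ with hψ
  have hψf : Hav1.fn ψ = f := rfl
  have hψg : Hav1.grad ψ = g := rfl
  refine ⟨ψ, ⟨ψ.integrableOn, ψ.2.2.2, fun χ => ?_⟩, ?_⟩
  · have l1 : Tendsto (fun n => (v n).fst χ) atTop (𝓝 (u.fst χ)) :=
      ((ContinuousLinearMap.apply ℝ ℝ χ).continuous.tendsto u.fst).comp hv1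
    have l2 : Tendsto (fun n => ⟪Hav1.fn (φ n), Hav1.fn χ⟫_ℝ) atTop (𝓝 ⟪f, Hav1.fn χ⟫_ℝ) :=
      hf.inner tendsto_const_nhds
    exact tendsto_nhds_unique l1 (l2.congr fun n => ((hφ n).2.2 χ).symm)
  obtain ⟨C, hC, hlow⟩ := exists_quadratic_lower_bound hFd hβ hF m
  obtain ⟨n1, hn1, ae1⟩ := exists_subseq_tendsto_ae hf
  obtain ⟨n2, hn2, ae2⟩ := exists_subseq_tendsto_ae (hg.comp hn1.tendsto_atTop)
  obtain ⟨n3, hn3, ae3⟩ := exists_subseq_tendsto_ae (hv2.comp (hn1.comp hn2).tendsto_atTop)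
  set k : ℕ → ℕ := fun i => n1 (n2 (n3 i)) with hk
  have hkt : Tendsto k atTop atTop := (hn1.comp (hn2.comp hn3)).tendsto_atTop
  set vol := ((volume : Measure (Space d)).restrict Ω).real univ with hvol
  have iq : ∀ w : LpOn Ω ℝ 2, Integrable (fun x => C * (1 + ‖w x‖ ^ 2)) (volume.restrict Ω) :=
    fun w => ((integrable_const _).add (integrable_norm_sq w)).const_mul _
  have eq : ∀ w : LpOn Ω ℝ 2, ∫ x in Ω, C * (1 + ‖w x‖ ^ 2) = C * (vol + ‖w‖ ^ 2) := fun w => by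
    rw [integral_const_mul, integral_add (integrable_const _) (integrable_norm_sq w),
      integral_norm_sq]
    simp [hvol]
  have hden := fun n => integrable_density hKL (v n).snd (hi n)
  have fatou := integrable_and_integral_le_of_tendsto (ν := volume.restrict Ω)
    (p := fun i x => ((1 / 2 * ‖Hav1.grad (φ (k i)) x‖ ^ 2 + F (m + Hav1.fn (φ (k i)) x))
      + 1 / 2 * ((v (k i)).snd x - K (m + Hav1.fn (φ (k i)) x)) ^ 2)
      + C * (1 + ‖Hav1.fn (φ (k i)) x‖ ^ 2))
    (q := fun x => ((1 / 2 * ‖g x‖ ^ 2 + F (m + f x))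
      + 1 / 2 * (u.snd x - K (m + f x)) ^ 2) + C * (1 + ‖f x‖ ^ 2))
    (y := y + C * (vol + ‖f‖ ^ 2))
    (fun i => (hden _).add (iq _))
    (fun i => Eventually.of_forall fun x => by
      have := hlow (Hav1.fn (φ (k i)) x)
      simp only [Pi.zero_apply, Real.norm_eq_abs, sq_abs]
      have h1 : 0 ≤ 1 / 2 * ‖Hav1.grad (φ (k i)) x‖ ^ 2 := by positivity
      have h2 : 0 ≤ 1 / 2 * ((v (k i)).snd x - K (m + Hav1.fn (φ (k i)) x)) ^ 2 := by positivity
      linarith)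
    (by
      filter_upwards [ae1, ae2, ae3] with x h1 h2 h3
      have h1' : Tendsto (fun i => Hav1.fn (φ (k i)) x) atTop (𝓝 (f x)) :=
        h1.comp (hn2.comp hn3).tendsto_atTop
      have h2' : Tendsto (fun i => Hav1.grad (φ (k i)) x) atTop (𝓝 (g x)) :=
        h2.comp hn3.tendsto_atTop
      have h3' : Tendsto (fun i => (v (k i)).snd x) atTop (𝓝 (u.snd x)) := h3
      have hF' := (hFd.continuous.tendsto _).comp (h1'.const_add m)
      have hK' := (hKL.continuous.tendsto _).comp (h1'.const_add m)
      exact ((((h2'.norm.pow 2).const_mul _).add hF').add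
        (((h3'.sub hK').pow 2).const_mul _)).add (((h1'.norm.pow 2).const_add 1).const_mul C))
    (by
      have e : ∀ i, ∫ x in Ω, (((1 / 2 * ‖Hav1.grad (φ (k i)) x‖ ^ 2
          + F (m + Hav1.fn (φ (k i)) x))
          + 1 / 2 * ((v (k i)).snd x - K (m + Hav1.fn (φ (k i)) x)) ^ 2)
          + C * (1 + ‖Hav1.fn (φ (k i)) x‖ ^ 2))
          = energyReal F K m (φ (k i)) (v (k i)).snd
            + C * (vol + ‖Hav1.fn (φ (k i))‖ ^ 2) := fun i => by
        rw [integral_add (hden _) (iq _), eq]; rfl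
      simp_rw [e]
      exact (hy.comp hkt).add ((((hf.comp hkt).norm.pow 2).const_add vol).const_mul C))
  obtain ⟨hq, hqy⟩ := fatou
  have iK := (memLp_sub_comp hKL m f u.snd).integrable_sq.const_mul (1 / 2)
  have iF : IntegrableOn (fun x => F (m + f x)) Ω := by
    have := ((hq.sub (iq f)).sub iK).sub ((integrable_norm_sq g).const_mul (1 / 2))
    refine this.congr (Eventually.of_forall fun x => ?_)
    simp only [Pi.sub_apply]
    ring
  refine ⟨iF, ?_⟩
  have iden := integrable_density (φ := ψ) hKL u.snd iF
  rw [hψf, hψg] at iden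
  rw [integral_add iden (iq f), eq] at hqy
  have : energyReal F K m ψ u.snd = ∫ x in Ω, ((1 / 2 * ‖g x‖ ^ 2 + F (m + f x))
      + 1 / 2 * (u.snd x - K (m + f x)) ^ 2) := rfl
  linarith

/-! ### Mollification of weakly differentiable functions -/

/-- The mollification of (the extension by zero of) a function `f` on `Ω` by a bump function. -/
noncomputable def mollify (Ω : Set (Space d)) {V : Type} [NormedAddCommGroup V] [NormedSpace ℝ V]
    (φ : ContDiffBump (0 : Space d)) (f : Space d → V) : Space d → V :=
  convolution (φ.normed volume) (Ω.indicator f) (ContinuousLinearMap.lsmul ℝ ℝ) volume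

section

variable {V : Type} [NormedAddCommGroup V]

lemma locallyIntegrable_indicator (hΩ : IsOpen Ω) {f : Space d → V}
    (hf : MemLp f 2 (volume.restrict Ω)) : LocallyIntegrable (Ω.indicator f) volume :=
  ((memLp_indicator_iff_restrict hΩ.measurableSet).2 hf).locallyIntegrable (by norm_num)

variable [NormedSpace ℝ V]

lemma continuous_mollify (hΩ : IsOpen Ω) (φ : ContDiffBump (0 : Space d)) {f : Space d → V}
    (hf : MemLp f 2 (volume.restrict Ω)) : Continuous (mollify Ω φ f) :=
  φ.hasCompactSupport_normed.continuous_convolution_left _ φ.continuous_normed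
    (locallyIntegrable_indicator hΩ hf)

lemma mollify_apply (hΩ : IsOpen Ω) (φ : ContDiffBump (0 : Space d)) (f : Space d → V)
    (x : Space d) : mollify Ω φ f x = ∫ t in Ω, φ.normed volume (x - t) • f t := by
  rw [mollify, convolution_eq_swap, ← integral_indicator hΩ.measurableSet]
  refine integral_congr_ae (Eventually.of_forall fun t => ?_)
  by_cases ht : t ∈ Ω <;> simp [ht]

lemma integrable_mollify_integrand (φ : ContDiffBump (0 : Space d))
    {f : Space d → V} (hf : MemLp f 2 (volume.restrict Ω)) (x : Space d) :
    Integrable (fun t => φ.normed volume (x - t) • f t) (volume.restrict Ω) := by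
  refine integrable_test_smul hf (φ.continuous_normed.comp (continuous_const.sub continuous_id)) ?_
  exact φ.hasCompactSupport_normed.comp_homeomorph (Homeomorph.subLeft x)

/-- At interior points, mollification commutes with weak differentiation. -/
lemma hasFDerivAt_mollify (hΩ : IsOpen Ω) {φ : ContDiffBump (0 : Space d)} [CompleteSpace V]
    {f : Space d → V} {g : Space d → (Space d →L[ℝ] V)} (hf : MemLp f 2 (volume.restrict Ω))
    (hg : MemLp g 2 (volume.restrict Ω)) (h : IsWeakFDeriv Ω f g) {x : Space d}
    (hx : Metric.closedBall x φ.rOut ⊆ Ω) :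
    HasFDerivAt (mollify Ω φ f) (mollify Ω φ g x) x := by
  have hloc := locallyIntegrable_indicator hΩ hf
  have hd := (φ.hasCompactSupport_normed (μ := volume)).hasFDerivAt_convolution_left (μ := volume)
    (ContinuousLinearMap.lsmul ℝ ℝ) (φ.contDiff_normed (n := 1)) hloc x
  have hconv := ((φ.hasCompactSupport_normed (μ := volume)).fderiv ℝ).convolutionExists_left (μ := volume)
    ((ContinuousLinearMap.lsmul ℝ ℝ : ℝ →L[ℝ] V →L[ℝ] V).precompL (Space d))
    ((φ.contDiff_normed (n := 1)).continuous_fderiv (by norm_num)) hloc x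
  suffices heq : mollify Ω φ g x = convolution (fderiv ℝ (φ.normed volume)) (Ω.indicator f)
      ((ContinuousLinearMap.lsmul ℝ ℝ : ℝ →L[ℝ] V →L[ℝ] V).precompL (Space d)) volume x by
    rw [heq]; exact hd
  refine ContinuousLinearMap.ext fun e => ?_
  rw [mollify_apply hΩ, ContinuousLinearMap.integral_apply (integrable_mollify_integrand φ hg x),
    convolution_eq_swap, ContinuousLinearMap.integral_apply hconv.integrable_swap]
  simp only [ContinuousLinearMap.precompL_apply, ContinuousLinearMap.lsmul_apply,
    smul_apply]
  set η : Space d → ℝ := fun t => φ.normed volume (x - t) with hη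
  have hη1 : ContDiff ℝ ∞ η := (φ.contDiff_normed (n := ⊤)).comp (contDiff_const.sub contDiff_id)
  have hη2 : HasCompactSupport η :=
    φ.hasCompactSupport_normed.comp_homeomorph (Homeomorph.subLeft x)
  have hη3 : tsupport η ⊆ Ω := by
    refine Subset.trans (closure_minimal ?_ Metric.isClosed_closedBall) hx
    intro t ht
    have h1 : x - t ∈ Function.support (φ.normed volume) := ht
    rw [φ.support_normed_eq, mem_ball_zero_iff] at h1
    rw [Metric.mem_closedBall, dist_comm, dist_eq_norm]
    exact h1.le
  have hη4 : ∀ t, fderiv ℝ η t e = -fderiv ℝ (φ.normed volume) (x - t) e := fun t => by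
    have h1 : HasFDerivAt (φ.normed volume) (fderiv ℝ (φ.normed volume) (x - t)) (x - t) :=
      ((φ.contDiff_normed (n := 1)).differentiable (by norm_num) _).hasFDerivAt
    have h2 := h1.comp t ((hasFDerivAt_const x t).sub (hasFDerivAt_id t))
    rw [show η = φ.normed volume ∘ HSub.hSub x from rfl, h2.fderiv]
    simp
  have hw := h η hη1 hη2 hη3 e
  simp only [hη4, neg_smul] at hw
  rw [integral_neg, neg_inj] at hw
  rw [← hw, ← integral_indicator hΩ.measurableSet]
  refine integral_congr_ae (Eventually.of_forall fun t => ?_)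
  by_cases ht : t ∈ Ω <;> simp [ht]

end

lemma hasFDerivAt_mollify_of_isWeakGrad (hΩ : IsOpen Ω) {φ : ContDiffBump (0 : Space d)}
    {f : Space d → ℝ} {g : Space d → Space d} (hf : MemLp f 2 (volume.restrict Ω))
    (hg : MemLp g 2 (volume.restrict Ω)) (h : IsWeakGrad Ω f g) {x : Space d}
    (hx : Metric.closedBall x φ.rOut ⊆ Ω) :
    HasFDerivAt (mollify Ω φ f) (innerSL ℝ (mollify Ω φ g x)) x := by
  have hg' := (innerSL ℝ (E := Space d)).comp_memLp' hg
  convert! hasFDerivAt_mollify hΩ hf hg' h hx using 1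
  ext e
  have i2 := integrable_mollify_integrand φ hg x
  rw [mollify_apply hΩ, mollify_apply hΩ,
    ContinuousLinearMap.integral_apply (integrable_mollify_integrand φ hg' x), innerSL_apply_apply,
    real_inner_comm, ← integral_inner i2]
  refine integral_congr_ae (Eventually.of_forall fun t => ?_)
  simp [real_inner_smul_right, real_inner_comm]

/-! ### The Sobolev embedding of `H²` into `L^∞` -/

/-- Taylor's formula along a segment, solved for the value at the starting point. -/
lemma abs_le_taylor {u : Space d → ℝ} {g : Space d → Space d} {G : Space d → Space d →L[ℝ] Space d}
    (hG : Continuous G) {x y : Space d}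
    (hu : ∀ s ∈ Icc (0 : ℝ) 1, HasFDerivAt u (innerSL ℝ (g (x + s • y))) (x + s • y))
    (hg : ∀ s ∈ Icc (0 : ℝ) 1, HasFDerivAt g (G (x + s • y)) (x + s • y)) :
    |u x| ≤ |u (x + y)| + ‖y‖ * ‖g (x + y)‖
      + ‖y‖ ^ 2 * ∫ s in (0 : ℝ)..1, s * ‖G (x + s • y)‖ := by
  have hray : ∀ s : ℝ, HasDerivAt (fun s : ℝ => x + s • y) y s := fun s => by
    simpa using ((hasDerivAt_id s).smul_const y).const_add x
  have hline : Continuous fun s : ℝ => x + s • y := by fun_prop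
  have hGc : Continuous fun s : ℝ => G (x + s • y) := hG.comp hline
  have hder : ∀ s ∈ uIcc (0 : ℝ) 1,
      HasDerivAt (fun s : ℝ => u (x + s • y) - s * ⟪g (x + s • y), y⟫_ℝ)
        (-(s * ⟪G (x + s • y) y, y⟫_ℝ)) s := by
    intro s hs
    rw [uIcc_of_le zero_le_one] at hs
    have d1 := (hu s hs).comp_hasDerivAt s (hray s)
    have d2 := ((hg s hs).comp_hasDerivAt s (hray s)).inner ℝ (hasDerivAt_const s y)
    have d3 := d1.sub ((hasDerivAt_id s).mul d2)
    convert! d3 using 1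
    simp
  have hcont : Continuous fun s : ℝ => -(s * ⟪G (x + s • y) y, y⟫_ℝ) := by fun_prop
  have hftc := intervalIntegral.integral_eq_sub_of_hasDerivAt hder
    (hcont.intervalIntegrable 0 1)
  simp only [one_smul, zero_smul, add_zero, one_mul, zero_mul, sub_zero] at hftc
  have hmaj : Continuous fun s : ℝ => ‖y‖ ^ 2 * (s * ‖G (x + s • y)‖) := by fun_prop
  have hI := intervalIntegral.norm_integral_le_of_norm_le (μ := volume)
    (f := fun s : ℝ => -(s * ⟪G (x + s • y) y, y⟫_ℝ)) zero_le_one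
    (Eventually.of_forall fun s hs => by
      have h1 : |⟪G (x + s • y) y, y⟫_ℝ| ≤ ‖G (x + s • y)‖ * ‖y‖ * ‖y‖ :=
        (abs_real_inner_le_norm _ _).trans
          (mul_le_mul_of_nonneg_right ((G _).le_opNorm y) (norm_nonneg _))
      have h2 := mul_le_mul_of_nonneg_left h1 hs.1.le
      rw [norm_neg, Real.norm_eq_abs, abs_mul, abs_of_pos hs.1]
      exact h2.trans (le_of_eq (by ring)))
    (hmaj.intervalIntegrable 0 1)
  rw [hftc, intervalIntegral.integral_const_mul, Real.norm_eq_abs] at hI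
  have h3 : |⟪g (x + y), y⟫_ℝ| ≤ ‖y‖ * ‖g (x + y)‖ := by
    rw [mul_comm]; exact abs_real_inner_le_norm _ _
  have e : u x = u (x + y) - ⟪g (x + y), y⟫_ℝ - (u (x + y) - ⟪g (x + y), y⟫_ℝ - u x) := by ring
  rw [e]
  have t1 := abs_sub (u (x + y) - ⟪g (x + y), y⟫_ℝ) (u (x + y) - ⟪g (x + y), y⟫_ℝ - u x)
  have t2 := abs_sub (u (x + y)) ⟪g (x + y), y⟫_ℝ
  linarith

section

variable {V : Type} [NormedAddCommGroup V]

lemma lintegral_add_smul_le (f : Space d → ℝ≥0∞) (hf : Measurable f) (a : Space d) {s : ℝ}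
    (hs : 0 < s) :
    ∫⁻ y, f (a + s • y) = ENNReal.ofReal ((s ^ d)⁻¹) * ∫⁻ y, f y := by
  have h1 : ∫⁻ y, f (a + s • y) = ∫⁻ z, f (a + z) ∂(Measure.map (fun y => s • y) volume) := by
    have hm : Measurable fun z => f (a + z) := hf.comp (measurable_const_add a)
    rw [lintegral_map hm (measurable_const_smul s)]
  rw [h1, Measure.map_addHaar_smul _ hs.ne', lintegral_smul_measure, lintegral_add_left_eq_self,
    smul_eq_mul, finrank_euclideanSpace, Fintype.card_fin, abs_of_pos (by positivity)]

/-- The `L¹` norm over a fixed set of a dilated `L²` function. -/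
lemma setLIntegral_enorm_add_smul_le {f : Space d → V} (hf : StronglyMeasurable f) (a : Space d)
    {s : ℝ} (hs : 0 < s) (B : Set (Space d)) :
    ∫⁻ y in B, ‖f (a + s • y)‖ₑ ≤
      volume B ^ (1 / 2 : ℝ) * ENNReal.ofReal ((s ^ d)⁻¹) ^ (1 / 2 : ℝ) * eLpNorm f 2 volume := by
  have hm : StronglyMeasurable (fun y => f (a + s • y)) :=
    hf.comp_measurable (by fun_prop)
  have h1 := eLpNorm_le_eLpNorm_mul_rpow_measure_univ (μ := volume.restrict B)
    (p := 1) (q := 2) (by norm_num) hm.aestronglyMeasurable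
  rw [eLpNorm_one_eq_lintegral_enorm] at h1
  refine h1.trans ?_
  rw [Measure.restrict_apply_univ]
  have h2 : eLpNorm (fun y => f (a + s • y)) 2 (volume.restrict B) ≤
      ENNReal.ofReal ((s ^ d)⁻¹) ^ (1 / 2 : ℝ) * eLpNorm f 2 volume := by
    refine (eLpNorm_mono_measure _ Measure.restrict_le_self).trans (le_of_eq ?_)
    rw [eLpNorm_eq_lintegral_rpow_enorm_toReal (by norm_num) (by norm_num),
      eLpNorm_eq_lintegral_rpow_enorm_toReal (by norm_num) (by norm_num),
      lintegral_add_smul_le (fun y => ‖f y‖ₑ ^ (2 : ℝ≥0∞).toReal)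
        (hf.enorm.pow_const _) a hs, ENNReal.mul_rpow_of_nonneg _ _ (by norm_num)]
    simp
  have h3 : (1 : ℝ) / (1 : ℝ≥0∞).toReal - 1 / (2 : ℝ≥0∞).toReal = 1 / 2 := by norm_num
  rw [h3, mul_comm, mul_assoc]
  gcongr

/-- Young's inequality in the form of the previous lemma for mollified functions. -/
lemma setLIntegral_enorm_mollify_le [NormedSpace ℝ V] (hΩ : IsOpen Ω)
    (φ : ContDiffBump (0 : Space d)) {f : Space d → V} (hf : StronglyMeasurable f) (x : Space d)
    {s : ℝ} (hs : 0 < s) (B : Set (Space d)) :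
    ∫⁻ y in B, ‖mollify Ω φ f (x + s • y)‖ₑ ≤
      volume B ^ (1 / 2 : ℝ) * ENNReal.ofReal ((s ^ d)⁻¹) ^ (1 / 2 : ℝ)
        * eLpNorm f 2 (volume.restrict Ω) := by
  rw [← eLpNorm_indicator_eq_eLpNorm_restrict hΩ.measurableSet]
  set F := Ω.indicator f
  have hF : StronglyMeasurable F := hf.indicator hΩ.measurableSet
  set c := volume B ^ (1 / 2 : ℝ) * ENNReal.ofReal ((s ^ d)⁻¹) ^ (1 / 2 : ℝ) * eLpNorm F 2 volume
  have hφ : Measurable fun w => ‖φ.normed volume w‖ₑ := φ.continuous_normed.enorm.measurable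
  calc ∫⁻ y in B, ‖mollify Ω φ f (x + s • y)‖ₑ
      ≤ ∫⁻ y in B, ∫⁻ w, ‖φ.normed volume w‖ₑ * ‖F (x + s • y - w)‖ₑ := by
        refine lintegral_mono fun y => ?_
        refine (enorm_integral_le_lintegral_enorm _).trans (le_of_eq ?_)
        simp only [ContinuousLinearMap.lsmul_apply, enorm_smul]
        rfl
    _ = ∫⁻ w, ∫⁻ y in B, ‖φ.normed volume w‖ₑ * ‖F (x + s • y - w)‖ₑ := by
        refine lintegral_lintegral_swap (Measurable.aemeasurable ?_)
        refine (hφ.comp measurable_snd).mul ?_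
        exact (hF.comp_measurable
          (by fun_prop : Measurable fun q : Space d × Space d => x + s • q.1 - q.2)).enorm
    _ ≤ ∫⁻ w, ‖φ.normed volume w‖ₑ * c := by
        refine lintegral_mono fun w => ?_
        have hm : Measurable fun y => ‖F (x + s • y - w)‖ₑ := (hF.comp_measurable
          (by fun_prop : Measurable fun y : Space d => x + s • y - w)).enorm
        rw [lintegral_const_mul _ hm]
        gcongr
        have := setLIntegral_enorm_add_smul_le hF (x - w) hs B
        simpa only [show ∀ y : Space d, x - w + s • y = x + s • y - w from fun y => by abel]
          using this
    _ = c := by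
        rw [lintegral_mul_const _ hφ]
        have : ∫⁻ w, ‖φ.normed volume w‖ₑ ∂(volume : Measure (Space d)) = 1 := by
          rw [← ENNReal.ofReal_one, ← φ.integral_normed (μ := volume),
            ofReal_integral_eq_lintegral_ofReal φ.integrable_normed
              (Eventually.of_forall φ.nonneg_normed)]
          exact lintegral_congr fun w => Real.enorm_of_nonneg (φ.nonneg_normed w)
        rw [this, one_mul]

end

/-- The factor `s ^ (1 - d / 2)` from the dilated `L²` norms in Taylor's remainder is integrable
near zero exactly for `d < 4`. -/
lemma lintegral_dilation_factor_lt_top (hd : d ≤ 3) :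
    ∫⁻ s in Ioc (0 : ℝ) 1, ENNReal.ofReal s * ENNReal.ofReal ((s ^ d)⁻¹) ^ (1 / 2 : ℝ) < ⊤ := by
  have hint : IntegrableOn (fun s : ℝ => s ^ (-1 / 2 : ℝ)) (Ioc 0 1) := by
    rw [← intervalIntegrable_iff_integrableOn_Ioc_of_le zero_le_one]
    exact intervalIntegral.intervalIntegrable_rpow' (by norm_num)
  refine lt_of_le_of_lt (lintegral_mono_ae ?_) hint.lintegral_lt_top
  filter_upwards [ae_restrict_mem measurableSet_Ioc] with s hs
  have hs0 : 0 < s := hs.1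
  rw [ENNReal.ofReal_rpow_of_pos (by positivity), ← ENNReal.ofReal_mul hs0.le]
  refine ENNReal.ofReal_le_ofReal ?_
  have h1 : (s ^ d)⁻¹ ≤ s ^ (-3 : ℝ) := by
    rw [Real.rpow_neg hs0.le]
    refine inv_anti₀ (by positivity) ?_
    rw [show (3 : ℝ) = ((3 : ℕ) : ℝ) by norm_num, Real.rpow_natCast]
    exact pow_le_pow_of_le_one hs0.le hs.2 hd
  calc s * ((s ^ d)⁻¹) ^ (1 / 2 : ℝ) ≤ s * (s ^ (-3 : ℝ)) ^ (1 / 2 : ℝ) := by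
        gcongr
    _ = s ^ (-1 / 2 : ℝ) := by
        rw [← Real.rpow_mul hs0.le]
        nth_rewrite 1 [← Real.rpow_one s]
        rw [← Real.rpow_add hs0]
        norm_num

/-- Averaging Taylor's formula over the base of a cone with vertex `x` that lies in `Ω` bounds a
mollified `H²` function at `x`. -/
lemma enorm_mollify_le (hΩ : IsOpen Ω) (U : H2 Ω) {φ : ContDiffBump (0 : Space d)}
    {x c : Space d} {ρ R : ℝ} (hc : ‖c‖ ≤ R)
    (hcone : ∀ y ∈ Metric.closedBall c ρ, ∀ s ∈ Icc (0 : ℝ) 1,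
      Metric.closedBall (x + s • y) φ.rOut ⊆ Ω) :
    ‖mollify Ω φ U.1.1 x‖ₑ * volume (Metric.closedBall (0 : Space d) ρ) ≤
      volume (Metric.closedBall (0 : Space d) ρ) ^ (1 / 2 : ℝ) *
        (1 + ENNReal.ofReal (R + ρ) + ENNReal.ofReal (R + ρ) ^ 2 *
          ∫⁻ s in Ioc (0 : ℝ) 1, ENNReal.ofReal s * ENNReal.ofReal ((s ^ d)⁻¹) ^ (1 / 2 : ℝ)) *
        ‖U‖ₑ := by
  set B := Metric.closedBall c ρ with hB
  have hvol : volume (Metric.closedBall (0 : Space d) ρ) = volume B :=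
    (Measure.addHaar_closedBall_center _ _ _).symm
  rw [hvol]
  set r := ENNReal.ofReal (R + ρ) with hr
  set u := mollify Ω φ U.1.1 with hu
  set g := mollify Ω φ U.1.2.1 with hg
  set G := mollify Ω φ U.1.2.2 with hG
  have cu : Continuous u := continuous_mollify hΩ φ (Lp.memLp _)
  have cg : Continuous g := continuous_mollify hΩ φ (Lp.memLp _)
  have cG : Continuous G := continuous_mollify hΩ φ (Lp.memLp _)
  have hy : ∀ y ∈ B, ‖u x‖ₑ ≤ ‖u (x + y)‖ₑ + r * ‖g (x + y)‖ₑ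
      + r ^ 2 * ∫⁻ s in Ioc (0 : ℝ) 1, ENNReal.ofReal s * ‖G (x + s • y)‖ₑ := by
    intro y hyB
    have hyn : ‖y‖ ≤ R + ρ := by
      have h1 := norm_le_norm_add_norm_sub c y
      rw [Metric.mem_closedBall, dist_eq_norm] at hyB
      linarith [norm_sub_rev c y]
    have ht := abs_le_taylor (u := u) (g := g) (G := G) cG (x := x) (y := y)
      (fun s hs => hasFDerivAt_mollify_of_isWeakGrad hΩ (Lp.memLp _) (Lp.memLp _) U.2.1
        (hcone y hyB s hs))
      (fun s hs => hasFDerivAt_mollify hΩ (Lp.memLp _) (Lp.memLp _) U.2.2 (hcone y hyB s hs))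
    have cGs : Continuous fun s : ℝ => s * ‖G (x + s • y)‖ := by fun_prop
    have hI : ENNReal.ofReal (∫ s in (0 : ℝ)..1, s * ‖G (x + s • y)‖)
        = ∫⁻ s in Ioc (0 : ℝ) 1, ENNReal.ofReal s * ‖G (x + s • y)‖ₑ := by
      rw [intervalIntegral.integral_of_le zero_le_one, ofReal_integral_eq_lintegral_ofReal]
      · refine setLIntegral_congr_fun measurableSet_Ioc fun s hs => ?_
        rw [ENNReal.ofReal_mul hs.1.le, ofReal_norm]
      · exact (cGs.intervalIntegrable 0 1).1
      · filter_upwards [ae_restrict_mem measurableSet_Ioc] with s hs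
        exact mul_nonneg hs.1.le (norm_nonneg _)
    have hI0 : 0 ≤ ∫ s in (0 : ℝ)..1, s * ‖G (x + s • y)‖ :=
      intervalIntegral.integral_nonneg zero_le_one fun s hs => mul_nonneg hs.1 (norm_nonneg _)
    have ht' : |u x| ≤ |u (x + y)| + (R + ρ) * ‖g (x + y)‖
        + (R + ρ) ^ 2 * ∫ s in (0 : ℝ)..1, s * ‖G (x + s • y)‖ := by
      refine ht.trans ?_
      gcongr
    have hRρ : 0 ≤ R + ρ := (norm_nonneg y).trans hyn
    rw [← hI, Real.enorm_eq_ofReal_abs, Real.enorm_eq_ofReal_abs, ← ofReal_norm (g (x + y)), hr,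
      ← ENNReal.ofReal_mul hRρ, ← ENNReal.ofReal_pow hRρ,
      ← ENNReal.ofReal_mul (by positivity),
      ← ENNReal.ofReal_add (by positivity) (by positivity),
      ← ENNReal.ofReal_add (by positivity) (by positivity)]
    exact ENNReal.ofReal_le_ofReal ht'
  have m1 : Measurable fun y => ‖u (x + y)‖ₑ := (by fun_prop : Continuous _).measurable
  have m2 : Measurable fun y => ‖g (x + y)‖ₑ := (by fun_prop : Continuous _).measurable
  have m3 : Measurable fun q : Space d × ℝ => ENNReal.ofReal q.2 * ‖G (x + q.2 • q.1)‖ₑ :=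
    (ENNReal.measurable_ofReal.comp measurable_snd).mul
      (by fun_prop : Continuous fun q : Space d × ℝ => ‖G (x + q.2 • q.1)‖ₑ).measurable
  set b := volume B ^ (1 / 2 : ℝ) with hb
  have young : ∀ (V : Type) [NormedAddCommGroup V] [NormedSpace ℝ V] (f : LpOn Ω V 2),
      ‖f‖ ≤ ‖U‖ → ∀ s : ℝ, 0 < s → ∫⁻ y in B, ‖mollify Ω φ f (x + s • y)‖ₑ ≤
        b * ENNReal.ofReal ((s ^ d)⁻¹) ^ (1 / 2 : ℝ) * ‖U‖ₑ := by
    intro V _ _ f hf s hs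
    refine (setLIntegral_enorm_mollify_le hΩ φ (Lp.stronglyMeasurable f) x hs B).trans ?_
    rw [← Lp.enorm_def]
    gcongr
    exact enorm_le_iff_norm_le.2 hf
  have hn1 : ‖U.1.1‖ ≤ ‖U‖ := norm_fst_le U.1
  have hn2 : ‖U.1.2.1‖ ≤ ‖U‖ := (norm_fst_le U.1.2).trans (norm_snd_le U.1)
  have hn3 : ‖U.1.2.2‖ ≤ ‖U‖ := (norm_snd_le U.1.2).trans (norm_snd_le U.1)
  have y1 : ∫⁻ y in B, ‖u (x + y)‖ₑ ≤ b * ‖U‖ₑ := by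
    simpa using young ℝ U.1.1 hn1 1 one_pos
  have y2 : ∫⁻ y in B, ‖g (x + y)‖ₑ ≤ b * ‖U‖ₑ := by
    simpa using young _ U.1.2.1 hn2 1 one_pos
  have y3 : ∫⁻ y in B, ∫⁻ s in Ioc (0 : ℝ) 1, ENNReal.ofReal s * ‖G (x + s • y)‖ₑ ≤
      b * (∫⁻ s in Ioc (0 : ℝ) 1, ENNReal.ofReal s * ENNReal.ofReal ((s ^ d)⁻¹) ^ (1 / 2 : ℝ))
        * ‖U‖ₑ := by
    rw [lintegral_lintegral_swap m3.aemeasurable]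
    have mf : Measurable fun s : ℝ =>
        ENNReal.ofReal s * ENNReal.ofReal ((s ^ d)⁻¹) ^ (1 / 2 : ℝ) := by fun_prop
    rw [mul_right_comm, mul_comm, ← lintegral_mul_const _ mf]
    refine setLIntegral_mono_ae (by fun_prop) (Eventually.of_forall fun s hs => ?_)
    have mG : Measurable fun y => ‖G (x + s • y)‖ₑ := (by fun_prop : Continuous _).measurable
    rw [lintegral_const_mul _ mG, mul_assoc]
    gcongr
    refine (young _ U.1.2.2 hn3 s hs.1).trans (le_of_eq (by ring))
  calc ‖u x‖ₑ * volume B = ∫⁻ _ in B, ‖u x‖ₑ := by rw [setLIntegral_const]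
    _ ≤ ∫⁻ y in B, (‖u (x + y)‖ₑ + r * ‖g (x + y)‖ₑ
      + r ^ 2 * ∫⁻ s in Ioc (0 : ℝ) 1, ENNReal.ofReal s * ‖G (x + s • y)‖ₑ) :=
        setLIntegral_mono' Metric.isClosed_closedBall.measurableSet hy
    _ = (∫⁻ y in B, ‖u (x + y)‖ₑ) + r * (∫⁻ y in B, ‖g (x + y)‖ₑ)
      + r ^ 2 * ∫⁻ y in B, ∫⁻ s in Ioc (0 : ℝ) 1, ENNReal.ofReal s * ‖G (x + s • y)‖ₑ := by
        rw [lintegral_add_left (f := fun y => ‖u (x + y)‖ₑ + r * ‖g (x + y)‖ₑ)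
            (m1.add (m2.const_mul _)), lintegral_add_left m1,
          lintegral_const_mul _ m2, lintegral_const_mul _ m3.lintegral_prod_right']
    _ ≤ b * ‖U‖ₑ + r * (b * ‖U‖ₑ) + r ^ 2 * (b * (∫⁻ s in Ioc (0 : ℝ) 1,
        ENNReal.ofReal s * ENNReal.ofReal ((s ^ d)⁻¹) ^ (1 / 2 : ℝ)) * ‖U‖ₑ) := by
        gcongr
    _ = _ := by ring

/-- The points of `Ω ∩ s` satisfy a cone condition in `Ω`: each is the vertex of the convex hull of
a point and a ball of radius `ρ`, whose centre has distance at most `R` from the point. -/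
def HasConeCondition (Ω s : Set (Space d)) (ρ R : ℝ) : Prop :=
  ∀ x ∈ Ω ∩ s, ∃ c : Space d, ‖c‖ ≤ R ∧
    ∀ y ∈ Metric.closedBall c ρ, ∀ t ∈ Icc (0 : ℝ) 1, x + t • y ∈ Ω

/-- The Sobolev embedding `H²(Ω) ⊂ L^∞(Ω)` for `d ≤ 3` and open sets with the cone condition. -/
lemma exists_ae_abs_le_norm_of_cone (hd : d ≤ 3) (hΩ : IsOpen Ω) {ρ R : ℝ} (hρ : 0 < ρ)
    (hcone : HasConeCondition Ω univ ρ R) :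
    ∃ C : ℝ, 0 ≤ C ∧ ∀ U : H2 Ω, ∀ᵐ x ∂(volume.restrict Ω), |U.1.1 x| ≤ C * ‖U‖ := by
  set w := volume (Metric.closedBall (0 : Space d) ρ) with hw
  have hw0 : w ≠ 0 := (Metric.measure_closedBall_pos _ _ hρ).ne'
  have hwt : w ≠ ⊤ := measure_closedBall_lt_top.ne
  set κ := ∫⁻ s in Ioc (0 : ℝ) 1, ENNReal.ofReal s * ENNReal.ofReal ((s ^ d)⁻¹) ^ (1 / 2 : ℝ)
  have hκ : κ < ⊤ := lintegral_dilation_factor_lt_top hd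
  set C : ℝ≥0∞ := (w ^ (1 / 2 : ℝ) * (1 + ENNReal.ofReal (R + ρ)
    + ENNReal.ofReal (R + ρ) ^ 2 * κ)) / w with hC
  have hCt : C ≠ ⊤ := by
    refine ENNReal.div_ne_top (ENNReal.mul_ne_top ?_ ?_) hw0
    · exact ENNReal.rpow_ne_top_of_nonneg (by norm_num) hwt
    · finiteness
  refine ⟨C.toReal, ENNReal.toReal_nonneg, fun U => ?_⟩
  let φ : ℕ → ContDiffBump (0 : Space d) := fun n =>
    ⟨1 / (2 * ((n : ℝ) + 1)), 1 / ((n : ℝ) + 1), by positivity,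
      one_div_lt_one_div_of_lt (by positivity) (by linarith [Nat.cast_nonneg (α := ℝ) n])⟩
  have hφ : Tendsto (fun n => (φ n).rOut) atTop (𝓝 0) := tendsto_one_div_add_atTop_nhds_zero_nat
  have hφK : ∀ᶠ n in atTop, (φ n).rOut ≤ 2 * (φ n).rIn := Eventually.of_forall fun n => by
    change 1 / ((n : ℝ) + 1) ≤ 2 * (1 / (2 * ((n : ℝ) + 1)))
    rw [one_div, one_div, mul_inv, mul_inv_cancel_left₀ two_ne_zero]
  have hae := ContDiffBump.ae_convolution_tendsto_right_of_locallyIntegrable hφ hφK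
    (locallyIntegrable_indicator hΩ (Lp.memLp U.1.1))
  refine (ae_restrict_iff' hΩ.measurableSet).2 ?_
  filter_upwards [hae] with x hx hxΩ
  rw [indicator_of_mem hxΩ] at hx
  obtain ⟨c, hcR, hc⟩ := hcone x ⟨hxΩ, mem_univ x⟩
  -- The cone is compact, so it has positive distance to the complement of `Ω`.
  set k : Set (Space d) :=
    (fun q : ℝ × Space d => x + q.1 • q.2) '' (Icc (0 : ℝ) 1 ×ˢ Metric.closedBall c ρ) with hk
  have hkc : IsCompact k :=
    (isCompact_Icc.prod (isCompact_closedBall c ρ)).image (by fun_prop)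
  have hkΩ : k ⊆ Ω := by
    rintro _ ⟨⟨s, y⟩, ⟨hs, hy⟩, rfl⟩
    exact hc y hy s hs
  obtain ⟨δ, hδ, hδΩ⟩ := hkc.exists_cthickening_subset_open hΩ hkΩ
  have hbound : ∀ᶠ n in atTop, ‖mollify Ω (φ n) U.1.1 x‖ ≤ C.toReal * ‖U‖ := by
    filter_upwards [hφ.eventually (gt_mem_nhds hδ)] with n hn
    have hsub : ∀ y ∈ Metric.closedBall c ρ, ∀ s ∈ Icc (0 : ℝ) 1,
        Metric.closedBall (x + s • y) (φ n).rOut ⊆ Ω := by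
      intro y hy s hs
      have hmem : x + s • y ∈ k := ⟨(s, y), ⟨hs, hy⟩, rfl⟩
      exact (Metric.closedBall_subset_closedBall hn.le).trans
        ((Metric.closedBall_subset_cthickening hmem δ).trans hδΩ)
    have h1 := enorm_mollify_le hΩ U hcR hsub
    have h2 : ‖mollify Ω (φ n) U.1.1 x‖ₑ ≤ C * ‖U‖ₑ := by
      have h3 := (ENNReal.le_div_iff_mul_le (Or.inl hw0) (Or.inl hwt)).2 h1
      rwa [hC, ENNReal.div_eq_inv_mul, mul_assoc, ← ENNReal.div_eq_inv_mul]
    have h4 := ENNReal.toReal_mono (ENNReal.mul_ne_top hCt enorm_ne_top) h2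
    rwa [ENNReal.toReal_mul, toReal_enorm, toReal_enorm] at h4
  exact le_of_tendsto hx.norm hbound

/-! ### The cone condition for admissible domains -/

lemma Convex.hasConeCondition (hc : Convex ℝ Ω) (ho : IsOpen Ω) (hne : Ω.Nonempty)
    (hb : Bornology.IsBounded Ω) : ∃ ρ R : ℝ, 0 < ρ ∧ HasConeCondition Ω univ ρ R := by
  obtain ⟨x₀, hx₀⟩ := hne
  obtain ⟨ρ, hρ, hball⟩ := Metric.nhds_basis_closedBall.mem_iff.1 (ho.mem_nhds hx₀)
  obtain ⟨R, hR⟩ := hb.subset_closedBall x₀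
  refine ⟨ρ, R, hρ, fun x hx => ⟨x₀ - x, ?_, fun y hy t ht => ?_⟩⟩
  · have := hR hx.1
    rwa [Metric.mem_closedBall, dist_comm, dist_eq_norm] at this
  · have hmem : x + y ∈ Ω := hball (by
      rw [Metric.mem_closedBall, dist_eq_norm] at hy ⊢
      rwa [show x + y - x₀ = y - (x₀ - x) by abel])
    have := hc.add_smul_sub_mem hx.1 hmem ht
    rwa [add_sub_cancel_left] at this

lemma HasConeCondition.mono {s : Set (Space d)} {ρ ρ' R R' : ℝ} (h : HasConeCondition Ω s ρ R)
    (hρ : ρ' ≤ ρ) (hR : R ≤ R') : HasConeCondition Ω s ρ' R' := by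
  intro x hx
  obtain ⟨c, hc, hcone⟩ := h x hx
  exact ⟨c, hc.trans hR, fun y hy => hcone y (Metric.closedBall_subset_closedBall hρ hy)⟩

/-- Near a point at which the boundary is the graph of a `C¹` function, which is locally Lipschitz,
small cones in the direction `e` stay above the graph. -/
lemma exists_hasConeCondition_of_graph {x₀ e : Space d} {r : ℝ} (hr : 0 < r) (he : ‖e‖ = 1)
    {γ : Space d → ℝ} (hγ : ContDiff ℝ 1 γ)
    (hgraph : Ω ∩ Metric.ball x₀ r =
      {x | γ (x - ⟪e, x⟫_ℝ • e) < ⟪e, x⟫_ℝ} ∩ Metric.ball x₀ r) :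
    ∃ s ∈ 𝓝 x₀, ∃ ρ R : ℝ, 0 < ρ ∧ HasConeCondition Ω s ρ R := by
  set π : Space d → Space d := fun x => x - ⟪e, x⟫_ℝ • e with hπ
  have hπc : Continuous π := by fun_prop
  obtain ⟨ℓ, t, ht, hℓ⟩ := (hγ.contDiffAt (x := π x₀)).exists_lipschitzOnWith
  have hpre : π ⁻¹' t ∈ 𝓝 x₀ := hπc.continuousAt.preimage_mem_nhds ht
  obtain ⟨r', hr', hball⟩ := Metric.mem_nhds_iff.1 hpre
  set η := min r r' with hη
  have hη0 : 0 < η := lt_min hr hr'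
  set δ := η / 8 with hδ
  set ρ := δ / (2 * (1 + ℓ)) with hρ
  have hδ0 : 0 < δ := by positivity
  have hρ0 : 0 < ρ := by positivity
  have hρδ : 2 * (ρ + ℓ * ρ) = δ := by rw [hρ]; field_simp
  have hℓρ : 0 ≤ ℓ * ρ := by positivity
  refine ⟨Metric.ball x₀ (η / 2), Metric.ball_mem_nhds _ (half_pos hη0), ρ, δ, hρ0, ?_⟩
  rintro x ⟨hxΩ, hx⟩
  have hee : ⟪e, e⟫_ℝ = 1 := by rw [real_inner_self_eq_norm_sq, he, one_pow]
  refine ⟨δ • e, by rw [norm_smul, he, mul_one, Real.norm_of_nonneg hδ0.le], fun y hy s hs => ?_⟩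
  rcases hs.1.eq_or_lt with h0 | h0
  · rw [← h0, zero_smul, add_zero]; exact hxΩ
  rw [Metric.mem_closedBall, dist_eq_norm] at hy
  set q := y - δ • e with hq
  have hyq : y = δ • e + q := by rw [hq]; abel
  have hyn : ‖y‖ ≤ 2 * δ := by
    have h1 := norm_add_le (δ • e) q
    rw [← hyq, norm_smul, he, mul_one, Real.norm_of_nonneg hδ0.le] at h1
    linarith
  have hsy : ‖s • y‖ ≤ 2 * δ := by
    rw [norm_smul, Real.norm_of_nonneg hs.1]
    calc s * ‖y‖ ≤ 1 * (2 * δ) := mul_le_mul hs.2 hyn (norm_nonneg _) zero_le_one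
      _ = _ := one_mul _
  have hxs : x + s • y ∈ Metric.ball x₀ η := by
    rw [Metric.mem_ball, dist_eq_norm] at hx ⊢
    have h1 := norm_add_le (x - x₀) (s • y)
    rw [show x - x₀ + s • y = x + s • y - x₀ by abel] at h1
    linarith
  have hxη : x ∈ Metric.ball x₀ η := Metric.ball_subset_ball (half_le_self hη0.le) hx
  have hin : ∀ z ∈ Metric.ball x₀ η, z ∈ Metric.ball x₀ r ∧ π z ∈ t := fun z hz =>
    ⟨Metric.ball_subset_ball (min_le_left _ _) hz,
      hball (Metric.ball_subset_ball (min_le_right _ _) hz)⟩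
  have hxg : γ (π x) < ⟪e, x⟫_ℝ := by
    have : x ∈ Ω ∩ Metric.ball x₀ r := ⟨hxΩ, (hin x hxη).1⟩
    rw [hgraph] at this
    exact this.1
  have hlip := hℓ.dist_le_mul _ (hin _ hxs).2 _ (hin _ hxη).2
  -- The direction `δ e` is invisible to the projection `π`.
  have hdiff : π (x + s • y) - π x = s • (q - ⟪e, q⟫_ℝ • e) := by
    simp only [hπ, hyq, inner_add_right, real_inner_smul_right, hee]
    module
  have hqe : |⟪e, q⟫_ℝ| ≤ ρ := by
    have := abs_real_inner_le_norm e q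
    rw [he, one_mul] at this
    exact this.trans hy
  have hqn : ‖q - ⟪e, q⟫_ℝ • e‖ ≤ 2 * ρ := by
    refine (norm_sub_le _ _).trans ?_
    rw [norm_smul, he, mul_one, Real.norm_eq_abs]
    linarith
  rw [dist_eq_norm, dist_eq_norm, hdiff, norm_smul, Real.norm_of_nonneg hs.1,
    Real.norm_eq_abs] at hlip
  have h2 : (ℓ : ℝ) * (s * ‖q - ⟪e, q⟫_ℝ • e‖) ≤ s * (ℓ * (2 * ρ)) := by
    rw [mul_left_comm]
    exact mul_le_mul_of_nonneg_left (mul_le_mul_of_nonneg_left hqn ℓ.2) hs.1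
  have h3 : ⟪e, x + s • y⟫_ℝ = ⟪e, x⟫_ℝ + s * (δ + ⟪e, q⟫_ℝ) := by
    rw [hyq, inner_add_right, real_inner_smul_right, inner_add_right, real_inner_smul_right, hee,
      mul_one]
  have h4 : s * (ℓ * (2 * ρ)) ≤ s * (δ + ⟪e, q⟫_ℝ) := by
    refine mul_le_mul_of_nonneg_left ?_ hs.1
    linarith [(abs_le.1 hqe).1]
  have hmem : x + s • y ∈ {x | γ (x - ⟪e, x⟫_ℝ • e) < ⟪e, x⟫_ℝ} ∩ Metric.ball x₀ r := by
    refine ⟨?_, (hin _ hxs).1⟩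
    change γ (π (x + s • y)) < ⟪e, x + s • y⟫_ℝ
    rw [h3]
    linarith [(abs_le.1 hlip).2]
  rw [← hgraph] at hmem
  exact hmem.1

lemma HasC11Boundary.hasConeCondition (h : HasC11Boundary Ω) (ho : IsOpen Ω)
    (hb : Bornology.IsBounded Ω) : ∃ ρ R : ℝ, 0 < ρ ∧ HasConeCondition Ω univ ρ R := by
  have hcomp : IsCompact (closure Ω) := hb.isCompact_closure
  have key : ∃ ρ R : ℝ, 0 < ρ ∧ HasConeCondition Ω (closure Ω) ρ R := by
    refine hcomp.induction_on (p := fun s => ∃ ρ R : ℝ, 0 < ρ ∧ HasConeCondition Ω s ρ R)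
      ⟨1, 0, one_pos, fun x hx => absurd hx.2 (notMem_empty x)⟩ ?_ ?_ ?_
    · rintro s t hst ⟨ρ, R, hρ, ht⟩
      exact ⟨ρ, R, hρ, fun x hx => ht x ⟨hx.1, hst hx.2⟩⟩
    · rintro s t ⟨ρ, R, hρ, hs⟩ ⟨ρ', R', hρ', ht⟩
      refine ⟨min ρ ρ', max R R', lt_min hρ hρ', ?_⟩
      rintro x ⟨hxΩ, hx | hx⟩
      · exact hs.mono (min_le_left _ _) (le_max_left _ _) x ⟨hxΩ, hx⟩
      · exact ht.mono (min_le_right _ _) (le_max_right _ _) x ⟨hxΩ, hx⟩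
    · intro x₀ hx₀
      by_cases hx : x₀ ∈ Ω
      · obtain ⟨ε, hε, hball⟩ := Metric.nhds_basis_closedBall.mem_iff.1 (ho.mem_nhds hx)
        refine ⟨Metric.ball x₀ (ε / 2), mem_nhdsWithin_of_mem_nhds
          (Metric.ball_mem_nhds _ (half_pos hε)), ε / 2, 0, half_pos hε, ?_⟩
        rintro x ⟨-, hxb⟩
        refine ⟨0, by simp, fun y hy t ht => hball ?_⟩
        rw [mem_closedBall_zero_iff] at hy
        rw [Metric.mem_ball, dist_eq_norm] at hxb
        rw [Metric.mem_closedBall, dist_eq_norm]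
        have h1 := norm_add_le (x - x₀) (t • y)
        rw [show x - x₀ + t • y = x + t • y - x₀ by abel, norm_smul,
          Real.norm_of_nonneg ht.1] at h1
        have h2 : t * ‖y‖ ≤ 1 * (ε / 2) := mul_le_mul ht.2 hy (norm_nonneg _) zero_le_one
        linarith
      · have hfr : x₀ ∈ frontier Ω := by
          rw [ho.frontier_eq]; exact ⟨hx₀, hx⟩
        obtain ⟨r, hr, e, he, γ, hγ, -, hgraph⟩ := h x₀ hfr
        obtain ⟨s, hs, hcone⟩ := exists_hasConeCondition_of_graph hr he hγ hgraph
        exact ⟨s, mem_nhdsWithin_of_mem_nhds hs, hcone⟩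
  obtain ⟨ρ, R, hρ, hc⟩ := key
  exact ⟨ρ, R, hρ, fun x hx => hc x ⟨hx.1, subset_closure hx.1⟩⟩

/-- The Sobolev embedding `H²(Ω) ⊂ L^∞(Ω)` for admissible domains in dimension at most three. -/
lemma IsAdmissibleDomain.exists_ae_abs_le_norm (hΩ : IsAdmissibleDomain Ω) (hd : d ≤ 3) :
    ∃ C : ℝ, 0 ≤ C ∧ ∀ U : H2 Ω, ∀ᵐ x ∂(volume.restrict Ω), |U.1.1 x| ≤ C * ‖U‖ := by
  obtain ⟨ρ, R, hρ, hcone⟩ : ∃ ρ R : ℝ, 0 < ρ ∧ HasConeCondition Ω univ ρ R :=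
    hΩ.convex_or_C11.elim
      (fun h => Convex.hasConeCondition h hΩ.isOpen hΩ.isConnected.nonempty hΩ.isBounded)
      (fun h => h.hasConeCondition hΩ.isOpen hΩ.isBounded)
  exact exists_ae_abs_le_norm_of_cone hd hΩ.isOpen hρ hcone

/-! ### The chain rule -/

lemma abs_pairing_le (μ : HStar Ω) (v : H Ω) : |pairing μ v| ≤ 2 * ‖μ‖ * ‖v‖ := by
  have h1 : |v.fst μ.fst| ≤ ‖v‖ * ‖μ‖ := (v.fst.le_opNorm μ.fst).trans
    (mul_le_mul (WithLp.norm_fst_le _ v) (WithLp.norm_fst_le _ μ) (norm_nonneg _) (norm_nonneg _))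
  have h2 : |⟪μ.snd, v.snd⟫_ℝ| ≤ ‖μ‖ * ‖v‖ := (abs_real_inner_le_norm _ _).trans
    (mul_le_mul (WithLp.norm_snd_le _ μ) (WithLp.norm_snd_le _ v) (norm_nonneg _) (norm_nonneg _))
  have h3 := abs_add_le (v.fst μ.fst) ⟪μ.snd, v.snd⟫_ℝ
  unfold pairing
  linarith

/-- The duality pairing as a continuous linear functional of its second argument. -/
noncomputable def pairingCLM (μ : HStar Ω) : H Ω →L[ℝ] ℝ :=
  LinearMap.mkContinuous
    { toFun := pairing μ
      map_add' := fun v w => by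
        change (v.fst + w.fst) μ.fst + ⟪μ.snd, v.snd + w.snd⟫_ℝ = _
        rw [_root_.add_apply, inner_add_right, pairing, pairing]
        ring
      map_smul' := fun c v => by
        change (c • v.fst) μ.fst + ⟪μ.snd, c • v.snd⟫_ℝ = _
        rw [_root_.smul_apply, real_inner_smul_right, pairing, RingHom.id_apply, smul_eq_mul,
          smul_eq_mul]
        ring }
    (2 * ‖μ‖) fun v => abs_pairing_le μ v

lemma pairingCLM_apply (μ : HStar Ω) (v : H Ω) : pairingCLM μ v = pairing μ v := rfl

/-- A one-sided estimate that is quadratically small determines the derivative. -/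
lemma deriv_eq_of_local_lower_bound {X : Type*} [NormedAddCommGroup X] [NormedSpace ℝ X]
    {f : ℝ → ℝ} {v : ℝ → X} {t f' lam : ℝ} {v' : X} (hf : HasDerivAt f f' t)
    (hv : HasDerivAt v v' t) (p : X →L[ℝ] ℝ)
    (h : ∀ᶠ s in 𝓝 t, f t + p (v s - v t) ≤ f s + lam * ‖v s - v t‖ ^ 2) : f' = p v' := by
  have hq : HasDerivAt (fun s => ‖v s - v t‖ ^ 2) 0 t := by
    rw [hasDerivAt_iff_isLittleO]
    have h1 : (fun s => ‖v s - v t‖ ^ 2) =O[𝓝 t] fun s => ‖s - t‖ ^ 2 :=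
      (hv.isBigO_sub.norm_norm).pow 2
    simpa using h1.trans_isLittleO (Asymptotics.isLittleO_pow_sub_sub t (by norm_num))
  have hp : HasDerivAt (fun s => p (v s - v t)) (p v') t := by
    have := p.hasFDerivAt.comp_hasDerivAt t (hv.sub_const (v t))
    exact this
  have hd := (hf.fun_sub hp).fun_add (hq.const_mul lam)
  have hmin : IsLocalMin (fun s => f s - p (v s - v t) + lam * ‖v s - v t‖ ^ 2) t := by
    filter_upwards [h] with s hs
    simp only [sub_self, map_zero, sub_zero, norm_zero]
    linarith
  have := hmin.hasDerivAt_eq_zero hd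
  linarith

/-- The condition `Represents w U.1.1` includes that `U` has mean zero, so it lies in `H^1_av(Ω)`
and coincides with every other representative of `w` there. -/
lemma fn_eq_of_represents_H2 {w : Hav1Dual Ω} {U : H2 Ω} (hU : Represents w U.1.1) {φ : Hav1 Ω}
    (hφ : Represents w (Hav1.fn φ)) : Hav1.fn φ = U.1.1 :=
  hφ.fn_eq (ψ := ⟨(U.1.1, U.1.2.1), U.2.1, hU.1, hU.2.1⟩) hU

lemma ae_abs_le_norm_top {ν : Measure (Space d)} (ζ : Lp ℝ ⊤ ν) : ∀ᵐ x ∂ν, |ζ x| ≤ ‖ζ‖ := by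
  filter_upwards [ae_le_eLpNormEssSup (f := ζ) (μ := ν)] with x hx
  rw [← eLpNorm_exponent_top, ← Lp.enorm_def] at hx
  exact enorm_le_iff_norm_le.1 hx

/-- In every interval there is a time of a prescribed set of full measure at which a function does
not exceed its average. -/
lemma exists_mem_mul_le_integral {κ : ℝ → ℝ} {α β : ℝ} (hαβ : α < β)
    (hκ : IntervalIntegrable κ volume α β) {G : Set ℝ}
    (hG : ∀ᵐ t ∂volume, t ∈ Ioc α β → t ∈ G) :
    ∃ c ∈ G, c ∈ Icc α β ∧ (β - α) * κ c ≤ ∫ t in α..β, κ t := by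
  have hpos : 0 < β - α := sub_pos.2 hαβ
  set D := ∫ t in α..β, κ t with hD
  by_contra! hcon
  have hae : ∀ᵐ t ∂(volume.restrict (Ioc α β)), 0 < κ t - D / (β - α) := by
    rw [ae_restrict_iff' measurableSet_Ioc]
    filter_upwards [hG] with t ht hmem
    have := hcon t (ht hmem) (Ioc_subset_Icc_self hmem)
    rw [sub_pos, div_lt_iff₀ hpos]
    linarith
  have hi : Integrable (fun t => κ t - D / (β - α)) (volume.restrict (Ioc α β)) :=
    hκ.1.sub (integrable_const _)
  have hz : ∫ t in α..β, (κ t - D / (β - α)) = 0 := by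
    rw [intervalIntegral.integral_sub hκ intervalIntegrable_const,
      intervalIntegral.integral_const, ← hD, smul_eq_mul]
    field_simp
    ring
  rw [intervalIntegral.integral_of_le hαβ.le] at hz
  have h0 := (integral_eq_zero_iff_of_nonneg_ae (hae.mono fun t ht => ht.le) hi).1 hz
  have hne : volume.restrict (Ioc α β) ≠ 0 := by
    rw [Ne, Measure.restrict_eq_zero, Real.volume_Ioc]
    simpa using hαβ
  have : NeBot (ae (volume.restrict (Ioc α β))) := ae_neBot.2 hne
  obtain ⟨t, h1, h2⟩ := (hae.and h0).exists
  exact h1.ne' h2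

/-- The chain rule for functions along an `AC²` curve that satisfy, at almost every time `t`, a lower
bound with linear part `p t` and a quadratic defect with integrable weight `lam t`. The bound for
the first-order term by increments of the primitive `I` uses `2ab ≤ a² + b²`, so that no
measurability of `e` enters. -/
lemma chain_rule_of_lower_bound {X : Type} [NormedAddCommGroup X] [NormedSpace ℝ X]
    {T : ℝ} (hT : 0 < T) {v : ℝ → X} (hv : IsAC2 T v) {P : ℝ → Prop} {e : ℝ → ℝ}
    {ρ : ℝ → ℝ → ℝ} (hρ : ∀ s t, 0 ≤ ρ s t) {p : ℝ → X →L[ℝ] ℝ} {g lam : ℝ → ℝ}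
    (hp : ∀ t x, |p t x| ≤ g t * ‖x‖)
    (hg : MemLp g 2 (volume.restrict (Ioo 0 T))) (hlam0 : ∀ t, 0 ≤ lam t)
    (hlamI : IntegrableOn lam (Ioo 0 T)) {G : Set ℝ} (hGT : G ⊆ Ioo 0 T)
    (hGae : ∀ᵐ t ∂(volume.restrict (Ioo 0 T)), t ∈ G) (hPG : ∀ t ∈ G, P t)
    (key : ∀ t ∈ G, ∀ s, P s →
      e t + p t (v s - v t) + ρ s t ≤ e s + lam t * ‖v s - v t‖ ^ 2)
    (closed : ∀ a ∈ Icc 0 T, ∀ (c : ℕ → ℝ) (y : ℝ), (∀ n, c n ∈ G) →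
      Tendsto (fun n => v (c n)) atTop (𝓝 (v a)) → Tendsto (fun n => e (c n)) atTop (𝓝 y) →
      (∀ ε > 0, ∃ N, ∀ j ≥ N, ∀ i ≥ j, ρ (c i) (c j) ≤ ε) → P a ∧ e a ≤ y) :
    (∀ t ∈ Icc 0 T, P t) ∧ AbsolutelyContinuousOnInterval e 0 T ∧
      ∀ᵐ t ∂(volume.restrict (Ioo 0 T)), HasDerivAt e (p t (deriv v t)) t := by
  set ν : ℝ → ℝ := fun r => ‖deriv v r‖ ^ 2 with hν
  have hνI : IntervalIntegrable ν volume 0 T := hv.intervalIntegrable_norm_sq hT.le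
  have hν0 : ∀ r, 0 ≤ ν r := fun r => sq_nonneg _
  set N := ∫ r in (0 : ℝ)..T, ν r with hN
  have hN0 : 0 ≤ N := intervalIntegral.integral_nonneg hT.le fun r _ => hν0 r
  set κ : ℝ → ℝ := fun t => g t ^ 2 + lam t * N with hκ
  have hκ0 : ∀ t, 0 ≤ κ t := fun t =>
    add_nonneg (sq_nonneg _) (mul_nonneg (hlam0 t) hN0)
  have hκI : IntervalIntegrable κ volume 0 T := by
    rw [intervalIntegrable_iff_integrableOn_Ioo_of_le hT.le]
    exact hg.integrable_sq.add (hlamI.mul_const N)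
  set I : ℝ → ℝ := fun t => ∫ r in (0 : ℝ)..t, (κ r + ν r) with hI
  have hkI : IntervalIntegrable (fun r => κ r + ν r) volume 0 T := hκI.add hνI
  have hmem : ∀ {t : ℝ}, t ∈ Icc 0 T → t ∈ uIcc 0 T := fun {t} ht => by
    rwa [uIcc_of_le hT.le]
  have hsubI : ∀ {s t : ℝ}, s ∈ Icc 0 T → t ∈ Icc 0 T → uIcc s t ⊆ uIcc 0 T := fun hs ht =>
    uIcc_subset_uIcc (hmem hs) (hmem ht)
  have h0m : (0 : ℝ) ∈ Icc 0 T := ⟨le_rfl, hT.le⟩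
  have hIdiff : ∀ s ∈ Icc 0 T, ∀ t ∈ Icc 0 T, I t - I s = ∫ r in s..t, (κ r + ν r) :=
    fun s hs t ht => intervalIntegral.integral_interval_sub_left
      (hkI.mono_set (hsubI h0m ht)) (hkI.mono_set (hsubI h0m hs))
  have hImono : MonotoneOn I (Icc 0 T) := fun s hs t ht hst => by
    rw [← sub_nonneg, hIdiff s hs t ht]
    exact intervalIntegral.integral_nonneg hst fun r _ => add_nonneg (hκ0 r) (hν0 r)
  have hIac : AbsolutelyContinuousOnInterval I 0 T :=
    hkI.absolutelyContinuousOnInterval_intervalIntegral (hmem h0m)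
  have hIcont : ContinuousOn I (Icc 0 T) := by
    have := hIac.continuousOn
    rwa [uIcc_of_le hT.le] at this
  have hvcont : ContinuousOn v (Icc 0 T) := by
    have := hv.1.continuousOn
    rwa [uIcc_of_le hT.le] at this
  have hincr' : ∀ s ∈ Icc 0 T, ∀ t ∈ Icc 0 T, s ≤ t → ‖v t - v s‖ ^ 2 ≤ (t - s) * N ∧
      ‖v t - v s‖ ^ 2 ≤ (t - s) * (I t - I s) := by
    intro s hs t ht hst
    have h1 := hv.norm_sub_sq_le hs.1 hst ht.2
    have h2 : ∫ r in s..t, ν r ≤ N :=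
      intervalIntegral.integral_mono_interval hs.1 hst ht.2
        (Eventually.of_forall fun r => hν0 r) hνI
    have h3 : ∫ r in s..t, ν r ≤ I t - I s := by
      rw [hIdiff s hs t ht]
      exact intervalIntegral.integral_mono_on hst (hνI.mono_set (hsubI hs ht))
        (hkI.mono_set (hsubI hs ht)) fun r _ => le_add_of_nonneg_left (hκ0 r)
    have h4 : 0 ≤ t - s := sub_nonneg.2 hst
    exact ⟨h1.trans (mul_le_mul_of_nonneg_left h2 h4), h1.trans (mul_le_mul_of_nonneg_left h3 h4)⟩
  have hincr : ∀ s ∈ Icc 0 T, ∀ t ∈ Icc 0 T, ‖v s - v t‖ ^ 2 ≤ |s - t| * N ∧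
      ‖v s - v t‖ ^ 2 ≤ |s - t| * |I s - I t| := by
    intro s hs t ht
    rcases le_total s t with h | h
    · rw [norm_sub_rev, abs_sub_comm s, abs_sub_comm (I s), abs_of_nonneg (sub_nonneg.2 h),
        abs_of_nonneg (sub_nonneg.2 (hImono hs ht h))]
      exact hincr' s hs t ht h
    · rw [abs_of_nonneg (sub_nonneg.2 h), abs_of_nonneg (sub_nonneg.2 (hImono ht hs h))]
      exact hincr' t ht s hs h
  obtain ⟨hPall, hest⟩ := chaining (P := P) (f := e) (κ := κ) (I := I) (ρ := ρ) (G := G)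
    hT hImono hIcont hκ0 hρ
    (fun α hα β hβ hlt => by
      have hae : ∀ᵐ t ∂volume, t ∈ Ioc α β → t ∈ G := by
        have h1 := (ae_restrict_iff' measurableSet_Ioo).1 hGae
        have h2 : ∀ᵐ r ∂(volume : Measure ℝ), r ≠ T := by simp [ae_iff, measure_singleton]
        filter_upwards [h1, h2] with r hr hrT hmr
        exact hr ⟨hα.1.trans_lt hmr.1, lt_of_le_of_ne (hmr.2.trans hβ.2) hrT⟩
      obtain ⟨c, hcG, hc, hcκ⟩ := exists_mem_mul_le_integral hlt
        (hκI.mono_set (hsubI hα hβ)) hae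
      refine ⟨c, hcG, hc, hcκ.trans ?_⟩
      rw [hIdiff α hα β hβ]
      exact intervalIntegral.integral_mono_on hlt.le (hκI.mono_set (hsubI hα hβ))
        (hkI.mono_set (hsubI hα hβ)) fun r _ => le_add_of_nonneg_right (hν0 r))
    hPG
    (fun t ht htI s hs hPs => by
      have h1 := key t ht s hPs
      have h2 := (abs_le.1 (hp t (v s - v t))).1
      obtain ⟨h3, h4⟩ := hincr s hs t htI
      have h5 := mul_le_mul_of_nonneg_left h3 (hlam0 t)
      have h6 : g t * ‖v s - v t‖ ≤ |s - t| * g t ^ 2 + |I s - I t| := by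
        refine le_of_sq_le_sq ?_ (by positivity)
        have h7 := mul_le_mul_of_nonneg_left h4 (sq_nonneg (g t))
        have h8 : 0 ≤ |s - t| * g t ^ 2 * |I s - I t| := by positivity
        nlinarith [sq_nonneg (|s - t| * g t ^ 2 - |I s - I t|)]
      simp only [hκ]
      linarith)
    (fun a ha c y hcG hca hcy hcρ hcI => closed a ha c y hcG
      ((hvcont a ha).tendsto.comp
        (tendsto_nhdsWithin_iff.2 ⟨hca, Eventually.of_forall hcI⟩)) hcy hcρ)
  have heac : AbsolutelyContinuousOnInterval e 0 T := by
    refine absolutelyContinuousOnInterval_of_dist_le (C := 19) hIac fun s hs t ht => ?_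
    rw [uIcc_of_le hT.le] at hs ht
    exact hest s hs t ht
  refine ⟨hPall, heac, ?_⟩
  have hdiff : ∀ᵐ t ∂(volume.restrict (Ioo 0 T)), DifferentiableAt ℝ e t := by
    rw [ae_restrict_iff' measurableSet_Ioo]
    filter_upwards [heac.ae_differentiableAt] with t ht htm
    exact ht (hmem (Ioo_subset_Icc_self htm))
  filter_upwards [hGae, hdiff, hv.2.1] with t htG hte htv
  have hd : deriv e t = p t (deriv v t) := by
    refine deriv_eq_of_local_lower_bound (lam := lam t) hte.hasDerivAt htv.hasDerivAt _ ?_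
    filter_upwards [Icc_mem_nhds (hGT htG).1 (hGT htG).2] with s hs
    linarith [key t htG s (hPall s hs), hρ s t]
  rw [← hd]
  exact hte.hasDerivAt

end PhaseSep

/-- Chain rule for the energy along curves. The curve `t ↦ v t` in `H` describes the curve
`u t = (m, 0) + v t` in the affine space `H_m`; the real function `e` is `E ∘ u` on `[0,T]`. -/
theorem proposition3p9 {d : ℕ} (hd : d = 1 ∨ d = 2 ∨ d = 3)
    (Ω : Set (Space d)) (hΩ : IsAdmissibleDomain Ω)
    (F : ℝ → ℝ) (hF : ContDiff ℝ 2 F)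
    (β : ℝ) (hβ : 0 < β) (hFβ : ∀ s : ℝ, -β ≤ deriv (deriv F) s)
    (hgrowth2 : d = 2 → ∃ c p : ℝ, 0 < c ∧ 1 ≤ p ∧ ∀ s : ℝ, |deriv F s| ≤ c * (|s| ^ p + 1))
    (hgrowth3 : d = 3 → ∃ c p : ℝ, 0 < c ∧ 1 ≤ p ∧ p ≤ 5 ∧
      ∀ s : ℝ, |deriv F s| ≤ c * (|s| ^ p + 1))
    (A : ℝ → ℝ) (hALip : ∃ L : ℝ≥0, LipschitzWith L A)
    (Amin Amax : ℝ) (hAmin : 0 < Amin) (hA : ∀ s : ℝ, Amin ≤ A s ∧ A s ≤ Amax)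
    (K : ℝ → ℝ) (hK0 : K 0 = 0) (hK : ∀ s : ℝ, HasDerivAt K (A s) s)
    (m T : ℝ) (hT : 0 < T)
    (v : ℝ → H Ω) (hv : IsAC2 T v) (hvreg : MemL2H2Linf T v)
    (μ : ℝ → HStar Ω) (hμ : MemLp μ 2 (volume.restrict (Ioo 0 T)))
    (hsub : ∀ᵐ t ∂(volume.restrict (Ioo 0 T)),
      μ t ∈ gateauxSubdiff (energy Ω F K m) (v t)) :
    ∃ e : ℝ → ℝ,
      (∀ t ∈ Icc 0 T, energy Ω F K m (v t) = (e t : EReal)) ∧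
      ((∀ s : ℝ, 0 ≤ F s) → ∀ t ∈ Icc 0 T, 0 ≤ e t) ∧
      AbsolutelyContinuousOnInterval e 0 T ∧
      ∀ᵐ t ∂(volume.restrict (Ioo 0 T)),
        HasDerivAt e (pairing (μ t) (deriv v t)) t := by
  classical
  have hd3 : d ≤ 3 := by omega
  have hΩo := hΩ.isOpen
  have hfin := hΩ.isFiniteMeasure
  obtain ⟨L, hL⟩ := hALip
  have hFd : Differentiable ℝ F := hF.differentiable (by norm_num)
  have hFc := convexOn_add_sq hF hFβ
  have hKL := lipschitzWith_of_hasDerivAt hAmin hA hK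
  set Λ := Amax.toNNReal
  obtain ⟨⟨U, hUL, hU⟩, ⟨ζ, hζL, hζ⟩⟩ := hvreg
  obtain ⟨C, hC, hsob⟩ := hΩ.exists_ae_abs_le_norm hd3
  -- The times at which the subdifferential inclusion and the regularity hold.
  set G : Set ℝ := {t | t ∈ Ioo 0 T ∧ μ t ∈ gateauxSubdiff (energy Ω F K m) (v t) ∧
    Represents (v t).fst (U t).1.1 ∧ ζ t =ᵐ[volume.restrict Ω] (v t).snd} with hG
  have hGae : ∀ᵐ t ∂(volume.restrict (Ioo 0 T)), t ∈ G := by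
    filter_upwards [hsub, hU, hζ, ae_restrict_mem measurableSet_Ioo] with t h1 h2 h3 h4
    exact ⟨h4, h1, h2, h3⟩
  set P : ℝ → Prop := fun t => ∃ φ : Hav1 Ω, Represents (v t).fst (Hav1.fn φ) ∧
    IntegrableOn (fun x => F (m + Hav1.fn φ x)) Ω with hP
  set Φ : ℝ → Hav1 Ω := fun t => if h : P t then h.choose else 0 with hΦ
  have hΦP : ∀ t, P t → Represents (v t).fst (Hav1.fn (Φ t)) ∧
      IntegrableOn (fun x => F (m + Hav1.fn (Φ t) x)) Ω := fun t ht => by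
    simp only [hΦ, dif_pos ht]; exact ht.choose_spec
  set e : ℝ → ℝ := fun t => energyReal F K m (Φ t) (v t).snd with he
  have hPG : ∀ t ∈ G, P t := fun t ht => exists_of_energy_ne_top ht.2.1.1
  -- Quantitative data: a bound for `z - K(u)`, the resulting defect of convexity, and its weight.
  set M : ℝ → ℝ := fun t => ‖ζ t‖ + (|K m| + Λ * (C * ‖U t‖)) with hM
  have hM0 : ∀ t, 0 ≤ M t := fun t => by positivity
  have hMb : ∀ t ∈ G, ∀ᵐ x ∂(volume.restrict Ω),
      |(v t).snd x - K (m + Hav1.fn (Φ t) x)| ≤ M t := by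
    intro t ht
    have hfn := fn_eq_of_represents_H2 ht.2.2.1 (hΦP t (hPG t ht)).1
    filter_upwards [ae_abs_le_norm_top (ζ t), hsob (U t), ht.2.2.2] with x h1 h2 h3
    rw [← h3, hfn]
    have h4 := hKL.dist_le_mul (m + (U t).1.1 x) m
    rw [Real.dist_eq, Real.dist_eq, add_sub_cancel_left] at h4
    have h5 := mul_le_mul_of_nonneg_left h2 (NNReal.coe_nonneg Λ)
    have h6 := abs_sub (ζ t x) (K (m + (U t).1.1 x))
    have h7 := abs_add_le (K m) (K (m + (U t).1.1 x) - K m)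
    rw [add_sub_cancel] at h7
    simp only [hM]
    linarith
  set lam : ℝ → ℝ := fun t => (β / 2 + M t * L) ^ 2 with hlam
  have hlamI : IntegrableOn lam (Ioo 0 T) := by
    have h1 : MemLp (fun t => Λ * (C * ‖U t‖)) 2 (volume.restrict (Ioo 0 T)) :=
      (hUL.norm.const_mul C).const_mul _
    have h2 : MemLp M 2 (volume.restrict (Ioo 0 T)) := hζL.norm.add ((memLp_const |K m|).add h1)
    have h3 : MemLp (fun t => M t * L) 2 (volume.restrict (Ioo 0 T)) := h2.mul_const _
    exact ((memLp_const (β / 2)).add h3).integrable_sq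
  have key : ∀ t ∈ G, ∀ s, P s → e t + pairingCLM (μ t) (v s - v t)
      + 1 / 4 * ‖Φ s - Φ t‖ ^ 2 ≤ e s + lam t * ‖v s - v t‖ ^ 2 := by
    intro t ht s hs
    have h1 := pairing_le_of_mem_gateauxSubdiff hΩo hFd hβ.le hFc hL hK hKL m
      (hΦP t (hPG t ht)).1 (hΦP s hs).1 (hΦP t (hPG t ht)).2 (hΦP s hs).2 (hM0 t) (hMb t ht)
      ht.2.1
    have h2 : ‖(v s - v t).fst‖ ^ 2 ≤ ‖v s - v t‖ ^ 2 :=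
      pow_le_pow_left₀ (norm_nonneg _) (WithLp.norm_fst_le _ _) 2
    have h3 := mul_le_mul_of_nonneg_left h2 (sq_nonneg (β / 2 + M t * L))
    rw [pairingCLM_apply]
    simp only [hlam, he]
    linarith
  have hμn : MemLp (fun t => ‖μ t‖) 2 (volume.restrict (Ioo 0 T)) := by
    refine ⟨hμ.1.norm, lt_of_eq_of_lt ?_ hμ.2⟩
    exact eLpNorm_congr_enorm_ae (Eventually.of_forall fun t => enorm_norm (μ t))
  obtain ⟨hPall, heac, hderiv⟩ := chain_rule_of_lower_bound (P := P) (e := e)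
    (ρ := fun s t => 1 / 4 * ‖Φ s - Φ t‖ ^ 2) (p := fun t => pairingCLM (μ t))
    (g := fun t => 2 * ‖μ t‖) (lam := lam) (G := G) hT hv
    (fun s t => by positivity) (fun t x => abs_pairing_le (μ t) x)
    (hμn.const_mul 2) (fun t => sq_nonneg _) hlamI (fun t ht => ht.1) hGae hPG key
    (fun a ha c y hcG hvt hcy hcρ => by
      obtain ⟨ψ, hψ1, hψ2, hψ3⟩ := energyReal_le_of_tendsto hFd hβ.le hFc hKL m hvt
        (fun n => (hΦP _ (hPG _ (hcG n))).1) (fun n => (hΦP _ (hPG _ (hcG n))).2)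
        (fun ε hε => by
          obtain ⟨n₀, hn₀⟩ := hcρ (1 / 4 * ε ^ 2) (by positivity)
          refine ⟨n₀, fun j hj i hi => ?_⟩
          have := hn₀ j hj i hi
          exact le_of_sq_le_sq (by linarith) hε.le) hcy
      have hPa : P a := ⟨ψ, hψ1, hψ2⟩
      refine ⟨hPa, ?_⟩
      have : Φ a = ψ := Hav1.ext_fn hΩo ((hΦP a hPa).1.fn_eq hψ1)
      simp only [he, this]
      exact hψ3)
  refine ⟨e, fun t ht => energy_eq_coe hΩo F K m (hΦP t (hPall t ht)).1 (hΦP t (hPall t ht)).2,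
    fun hF0 t _ => integral_nonneg fun x => ?_, heac, hderiv⟩
  have := hF0 (m + Hav1.fn (Φ t) x)
  simp only [Pi.zero_apply]
  positivity
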